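/- Conventions. A digraph $D$ is a vertex set with a set of ordered pairs of vertices (edges); all digraphs are asymmetric: if $(u,v)$ is an edge then $(v,u)$ is not (in particular there are no loops). Subsets of $D$ carry the full induced digraph structure. For $s\ge 0$, an $s$-arc from $u$ to $v$ is a sequence $u=u_0,u_1,\dots,u_s=v$ with $(u_i,u_{i+1})$ an edge for $0\le i<s$ and $u_{i-1}\neq u_{i+1}$ for $0<i<s$; $D^s(u)$ is the set of vertices reachable from $u$ by an $s$-arc, and the descendant set of $u$ is $D(u)=\mathrm{desc}(u)=\bigcup_{s\ge0}D^s(u)$. For $A\subseteq D$ write $A\le D$ if $\mathrm{desc}(a)\subseteq A$ for all $a\in A$; such an $A$ is finitely generated if $A=\bigcup_{a\in X}\mathrm{desc}(a)$ for some finite $X\subseteq A$ (possibly $X = \emptyset$). Write $A\le^+D$ if $A\le D$ and, for every $b\in D$, (i) if $\mathrm{desc}(b)\setminus A$ is finite then $b\in A$, and (ii) $\mathrm{desc}(b)\cap A$ is finitely generated. A digraph is primitive if its automorphism group acts primitively on its vertices (transitively, with no non-trivial invariant equivalence relation), and distance transitive if for every $s\ge0$ its automorphism group is transitive on the pairs $(u,v)$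 for which there is an $s$-arc from $u$ to $v$ but no $t$-arc with $t<s$. Theorem. Let $\Gamma$ be a digraph with a vertex $\gamma$ such that P0: every vertex of $\Gamma$ is a descendant of $\gamma$, all vertices of $\Gamma$ have the same finite out-valency $m>0$, and $\Gamma^s(\gamma)\cap\Gamma^t(\gamma)=\emptyset$ whenever $s\ne t$; P1: $\Gamma(u)\cong\Gamma$ for all $u\in\Gamma$; P2: $\mathrm{desc}(a)\le^+\Gamma$ for all $a\in\Gamma$; P3: for every $n\ge 0$, $\mathrm{Aut}(\Gamma)$ is transitive on $\Gamma^n(\gamma)$. Then there is a non-empty countable digraph $D_\Gamma$ which is primitive and distance transitive, in which every vertex has infinite in-valency, and in which $\mathrm{desc}(a)\cong\Gamma$ for every vertex $a$. -/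

import Mathlib

namespace Digraph

/-- A digraph without loops and without pairs of oppositely directed edges. -/
def IsAsymmetric {V : Type*} (D : Digraph V) : Prop :=
  ∀ u v, D.Adj u v → ¬ D.Adj v u

/-- Isomorphisms of digraphs. -/
abbrev Iso {V W : Type*} (D : Digraph V) (E : Digraph W) : Type _ :=
  D.Adj ≃r E.Adj

/-- The automorphism group of a digraph; it acts on the vertices by evaluation. -/
abbrev Aut {V : Type*} (D : Digraph V) : Type _ :=
  D.Adj ≃r D.Adj

/-- The full induced subdigraph on a set of vertices. -/
def induced {V : Type*} (D : Digraph V) (A : Set V) : Digraph A where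
  Adj a b := D.Adj a b

/-- The set of out-vertices of `v`. -/
def outSet {V : Type*} (D : Digraph V) (v : V) : Set V := {w | D.Adj v w}

/-- The set of in-vertices of `v`. -/
def inSet {V : Type*} (D : Digraph V) (v : V) : Set V := {w | D.Adj w v}

/-- There is an `s`-arc `p 0, p 1, …, p s` from `u` to `v`
(the values of `p` beyond `s` play no role). -/
def HasArc {V : Type*} (D : Digraph V) (s : ℕ) (u v : V) : Prop :=
  ∃ p : ℕ → V, p 0 = u ∧ p s = v ∧ (∀ i, i < s → D.Adj (p i) (p (i + 1))) ∧
    ∀ i, i + 1 < s → p i ≠ p (i + 2)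

/-- The vertices reachable from `u` by an `s`-arc. -/
def layer {V : Type*} (D : Digraph V) (s : ℕ) (u : V) : Set V := {v | D.HasArc s u v}

/-- The descendant set of `u`. -/
def desc {V : Type*} (D : Digraph V) (u : V) : Set V := ⋃ s, D.layer s u

/-- `A ≤ D`: the set `A` is closed under taking descendants. -/
def IsDescClosed {V : Type*} (D : Digraph V) (A : Set V) : Prop :=
  ∀ a ∈ A, D.desc a ⊆ A

/-- `A ≤ D` is finitely generated (the empty set is, by the empty generating set). -/
def IsFinGen {V : Type*} (D : Digraph V) (A : Set V) : Prop :=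
  D.IsDescClosed A ∧ ∃ X : Set V, X.Finite ∧ X ⊆ A ∧ A = ⋃ a ∈ X, D.desc a

/-- The relation `A ≤⁺ D`. -/
structure IsStrong {V : Type*} (D : Digraph V) (A : Set V) : Prop where
  closed : D.IsDescClosed A
  mem_of_finite_diff : ∀ b, (D.desc b \ A).Finite → b ∈ A
  finGen_inter : ∀ b, D.IsFinGen (D.desc b ∩ A)

/-- P0: `Γ` is rooted at `γ`, has finite constant out-valency `m > 0`, and the layers
below `γ` are pairwise disjoint. -/
structure P0 {V : Type*} (Γ : Digraph V) (γ : V) : Prop where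
  rooted : Γ.desc γ = Set.univ
  outValency : ∃ m : ℕ, 0 < m ∧ ∀ v, (Γ.outSet v).encard = m
  disjoint_layers : ∀ s t : ℕ, s ≠ t → Γ.layer s γ ∩ Γ.layer t γ = ∅

/-- P1: the digraph induced on the descendants of any vertex is isomorphic to `Γ`. -/
def P1 {V : Type*} (Γ : Digraph V) : Prop :=
  ∀ u, Nonempty (Iso (Γ.induced (Γ.desc u)) Γ)

/-- P2: `desc(a) ≤⁺ Γ` for all vertices `a`. -/
def P2 {V : Type*} (Γ : Digraph V) : Prop :=
  ∀ a, Γ.IsStrong (Γ.desc a)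

/-- P3: the automorphism group is transitive on each layer below the root `γ`. -/
def P3 {V : Type*} (Γ : Digraph V) (γ : V) : Prop :=
  ∀ n : ℕ, ∀ u ∈ Γ.layer n γ, ∀ v ∈ Γ.layer n γ, ∃ g : Γ.Aut, g u = v

/-- A digraph is primitive if its automorphism group is primitive on the vertices. -/
def IsPrimitive {V : Type*} (D : Digraph V) : Prop :=
  MulAction.IsPreprimitive D.Aut V

/-- There is an `s`-arc from `u` to `v`, but no `t`-arc with `t < s`. -/
def IsAtDist {V : Type*} (D : Digraph V) (s : ℕ) (u v : V) : Prop :=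
  D.HasArc s u v ∧ ∀ t, t < s → ¬ D.HasArc t u v

/-- Directed distance transitivity. -/
def IsDistanceTransitive {V : Type*} (D : Digraph V) : Prop :=
  ∀ (s : ℕ) (u v u' v' : V), D.IsAtDist s u v → D.IsAtDist s u' v' →
    ∃ g : D.Aut, g u = u' ∧ g v = v'

end Digraph

/-!
Call a digraph `D` locally `Γ` if each `desc(a) ≤⁺ D` is a copy of `Γ`. Isomorphisms between
strong sets `A ≤⁺ D` can be amalgamated freely: glue to `D`, for each of them, a further copy of
`D` along it. The result is again locally `Γ`, and the union of the iterated amalgams is a digraph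
in which every isomorphism between finitely generated strong sets extends to an automorphism,
which moreover may be taken to move any other vertices freely. With P3 this gives distance
transitivity; moving an in-neighbour of `a` while fixing `desc(a)` gives infinite in-valency.

For primitivity, let `∼` be an invariant equivalence relation and `a ∼ b` with `b ∉ desc(a)`.
Moving `desc(b)` freely over `desc(a)` yields two equivalent copies of `Γ` that meet in a finitely
generated coinfinite set `Z ⊆ Γ`, and by free moves the possible `Z` are closed under
intersections and automorphisms of `Γ`. Far down in `Γ` such a `Z` contains all parents of its
vertices, because the numbers of ancestors in a fixed layer are bounded; so finitely many
translates of `Z` have empty intersection. Hence there are equivalent vertices with disjoint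
descendant sets, then equivalent vertices in free position. All pairs in free position are
conjugate, and any two vertices are both in free position to some third one.

The union is uncountable in general; a Löwenheim–Skolem argument finds a countable subdigraph
closed under descendants which inherits these properties, as primitivity has a finitary form.
-/

namespace StrongDesc

open Digraph Set Relation

universe u v w

section Walks

variable {V : Type u} {W : Type v} {D : Digraph V} {E : Digraph W}

/-- There is a walk with `s` edges from `u` to `v`. In an asymmetric digraph these are the
`s`-arcs, since a walk can never turn back. -/
def HasWalk (D : Digraph V) : ℕ → V → V → Prop
  | 0, u, v => u = v
  | s + 1, u, v => ∃ w, HasWalk D s u w ∧ D.Adj w v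

theorem hasWalk_of_hasArc {s : ℕ} {u v : V} (h : D.HasArc s u v) : HasWalk D s u v := by
  obtain ⟨p, rfl, rfl, hp, -⟩ := h
  induction s with
  | zero => exact rfl
  | succ s ih => exact ⟨p s, ih fun i hi => hp i (by lia), hp s (by lia)⟩

theorem HasWalk.exists_seq {s : ℕ} {u v : V} (h : HasWalk D s u v) :
    ∃ p : ℕ → V, p 0 = u ∧ p s = v ∧ ∀ i, i < s → D.Adj (p i) (p (i + 1)) := by
  induction s generalizing v with
  | zero => exact ⟨fun _ => u, rfl, h, fun i hi => by lia⟩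
  | succ s ih =>
    obtain ⟨w, hw, hwv⟩ := h
    obtain ⟨p, h0, hs, hp⟩ := ih hw
    refine ⟨fun i => if i ≤ s then p i else v, by simp [h0], by simp, fun i hi => ?_⟩
    rcases Nat.lt_succ_iff_lt_or_eq.1 hi with h | rfl
    · simpa [h.le, Nat.succ_le_of_lt h] using hp i h
    · simpa [hs] using hwv

theorem HasWalk.hasArc (hD : D.IsAsymmetric) {s : ℕ} {u v : V} (h : HasWalk D s u v) :
    D.HasArc s u v := by
  obtain ⟨p, h0, hs, hp⟩ := h.exists_seq
  refine ⟨p, h0, hs, hp, fun i hi hturn => hD _ _ (hp i (by lia)) ?_⟩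
  exact hturn ▸ hp (i + 1) hi

theorem mem_layer_iff (hD : D.IsAsymmetric) {s : ℕ} {u v : V} :
    v ∈ D.layer s u ↔ HasWalk D s u v :=
  ⟨hasWalk_of_hasArc, HasWalk.hasArc hD⟩

theorem HasWalk.trans {s t : ℕ} {u v w : V} (h : HasWalk D s u v) (h' : HasWalk D t v w) :
    HasWalk D (s + t) u w := by
  induction t generalizing w with
  | zero => cases h'; exact h
  | succ t ih =>
    obtain ⟨x, hx, hxw⟩ := h'
    exact ⟨x, ih hx, hxw⟩

theorem HasWalk.map (f : D.Adj →r E.Adj) {s : ℕ} {u v : V} (h : HasWalk D s u v) :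
    HasWalk E s (f u) (f v) := by
  induction s generalizing v with
  | zero => exact congrArg f h
  | succ s ih =>
    obtain ⟨w, hw, hwv⟩ := h
    exact ⟨f w, ih hw, f.map_rel hwv⟩

theorem exists_hasWalk_iff {u v : V} : (∃ s, HasWalk D s u v) ↔ ReflTransGen D.Adj u v := by
  constructor
  · rintro ⟨s, h⟩
    induction s generalizing v with
    | zero => cases h; exact .refl
    | succ s ih =>
      obtain ⟨w, hw, hwv⟩ := h
      exact (ih hw).tail hwv
  · intro h
    induction h with
    | refl => exact ⟨0, rfl⟩
    | tail _ hwv ih => exact ⟨_ + 1, _, ih.choose_spec, hwv⟩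

theorem mem_desc_iff (hD : D.IsAsymmetric) {u v : V} :
    v ∈ D.desc u ↔ ReflTransGen D.Adj u v := by
  simp only [desc, mem_iUnion, mem_layer_iff hD, exists_hasWalk_iff]

end Walks

section DescendantClosedSets

variable {V : Type u} {D : Digraph V}

theorem self_mem_desc (hD : D.IsAsymmetric) (u : V) : u ∈ D.desc u :=
  (mem_desc_iff hD).2 .refl

theorem isDescClosed_desc (hD : D.IsAsymmetric) (u : V) : D.IsDescClosed (D.desc u) :=
  fun _ hv _ hw =>
    (mem_desc_iff hD).2 (((mem_desc_iff hD).1 hv).trans ((mem_desc_iff hD).1 hw))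

theorem isDescClosed_iff (hD : D.IsAsymmetric) {A : Set V} :
    D.IsDescClosed A ↔ ∀ a ∈ A, ∀ b, D.Adj a b → b ∈ A := by
  constructor
  · intro h a ha b hab
    exact h a ha ((mem_desc_iff hD).2 (.single hab))
  · intro h a ha b hb
    rw [mem_desc_iff hD] at hb
    induction hb with
    | refl => exact ha
    | tail _ h2 ih => exact h _ ih _ h2

theorem isDescClosed_union {A B : Set V} (hA : D.IsDescClosed A) (hB : D.IsDescClosed B) :
    D.IsDescClosed (A ∪ B) := fun a ha =>
  ha.elim (fun h => (hA a h).trans subset_union_left) fun h => (hB a h).trans subset_union_right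

theorem isDescClosed_iInter {ι : Sort*} {A : ι → Set V} (hA : ∀ i, D.IsDescClosed (A i)) :
    D.IsDescClosed (⋂ i, A i) := fun a ha =>
  subset_iInter fun i => hA i a (mem_iInter.1 ha i)

theorem isFinGen_empty (D : Digraph V) : D.IsFinGen ∅ :=
  ⟨fun _ h => h.elim, ∅, finite_empty, Subset.rfl, by simp⟩

theorem isFinGen_desc (hD : D.IsAsymmetric) (u : V) : D.IsFinGen (D.desc u) :=
  ⟨isDescClosed_desc hD u, {u}, finite_singleton u, by simpa using self_mem_desc hD u, by simp⟩

theorem isFinGen_union {A B : Set V} (hA : D.IsFinGen A) (hB : D.IsFinGen B) :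
    D.IsFinGen (A ∪ B) := by
  obtain ⟨hA, X, hX, hXA, hX'⟩ := hA
  obtain ⟨hB, Y, hY, hYB, hY'⟩ := hB
  exact ⟨isDescClosed_union hA hB, X ∪ Y, hX.union hY, union_subset_union hXA hYB, by
    rw [biUnion_union, ← hX', ← hY']⟩

theorem isFinGen_biUnion {ι : Type*} {X : Set ι} (hX : X.Finite) {A : ι → Set V}
    (hA : ∀ x ∈ X, D.IsFinGen (A x)) : D.IsFinGen (⋃ x ∈ X, A x) := by
  induction X, hX using Set.Finite.induction_on with
  | empty => simpa using isFinGen_empty D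
  | insert _ _ ih =>
    rw [biUnion_insert]
    exact isFinGen_union (hA _ (mem_insert _ _)) (ih fun x hx => hA x (mem_insert_of_mem _ hx))

theorem isStrong_univ (hD : D.IsAsymmetric) : D.IsStrong univ where
  closed _ _ := subset_univ _
  mem_of_finite_diff _ _ := mem_univ _
  finGen_inter b := by simpa using isFinGen_desc hD b

theorem isStrong_of_isStrong_of_subset {S A : Set V} (hS : D.IsStrong S) (hAS : A ⊆ S)
    (hA : D.IsDescClosed A) (hfinite : ∀ c ∈ S, (D.desc c \ A).Finite → c ∈ A)
    (hfinGen : ∀ c ∈ S, D.IsFinGen (D.desc c ∩ A)) : D.IsStrong A where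
  closed := hA
  mem_of_finite_diff b hb :=
    hfinite b (hS.mem_of_finite_diff b (hb.subset (sdiff_subset_sdiff_right hAS))) hb
  finGen_inter b := by
    obtain ⟨-, X, hX, hXS, hXe⟩ := hS.finGen_inter b
    have hcover : D.desc b ∩ A = ⋃ a ∈ X, D.desc a ∩ A := by
      rw [← iUnion₂_inter, ← hXe, inter_assoc, inter_eq_self_of_subset_right hAS]
    rw [hcover]
    exact isFinGen_biUnion hX fun x hx => hfinGen x (hXS hx).2

end DescendantClosedSets

section Embeddings

variable {V : Type u} {W : Type v} {D : Digraph V} {E : Digraph W}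

theorem isAsymmetric_of_embedding (i : D.Adj ↪r E.Adj) (hE : E.IsAsymmetric) :
    D.IsAsymmetric := fun _ _ h h' =>
  hE _ _ (i.map_rel_iff.2 h) (i.map_rel_iff.2 h')

variable (i : D.Adj ↪r E.Adj)

theorem exists_embedding_of_range_subset {X : Type w} {F : Digraph X} (k : F.Adj ↪r E.Adj)
    (h : range k ⊆ range i) : ∃ f : F.Adj ↪r D.Adj, ∀ x, i (f x) = k x := by
  choose f hf using fun x => h (mem_range_self x)
  refine ⟨⟨⟨f, fun x y hxy => k.injective ?_⟩, fun {x y} => ?_⟩, hf⟩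
  · rw [← hf, ← hf, hxy]
  · rw [← k.map_rel_iff, ← hf, ← hf, i.map_rel_iff]
    rfl

theorem HasWalk.exists_of_apply (hE : E.IsAsymmetric) (hi : E.IsDescClosed (range i)) {s : ℕ}
    {x : V} {y : W} (h : HasWalk E s (i x) y) : ∃ z, i z = y ∧ HasWalk D s x z := by
  induction s generalizing y with
  | zero => exact ⟨x, h, rfl⟩
  | succ s ih =>
    obtain ⟨_, hw, hwy⟩ := h
    obtain ⟨w, rfl, hxw⟩ := ih hw
    obtain ⟨z, rfl⟩ := (isDescClosed_iff hE).1 hi _ ⟨w, rfl⟩ _ hwy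
    exact ⟨z, rfl, w, hxw, i.map_rel_iff.1 hwy⟩

theorem desc_apply (hE : E.IsAsymmetric) (hi : E.IsDescClosed (range i)) (x : V) :
    E.desc (i x) = i '' D.desc x := by
  have hD := isAsymmetric_of_embedding i hE
  ext y
  simp only [mem_image, mem_desc_iff hD, mem_desc_iff hE, ← exists_hasWalk_iff]
  constructor
  · rintro ⟨s, h⟩
    obtain ⟨z, hz, hxz⟩ := h.exists_of_apply i hE hi
    exact ⟨z, ⟨s, hxz⟩, hz⟩
  · rintro ⟨z, ⟨s, hxz⟩, rfl⟩
    exact ⟨s, hxz.map i.toRelHom⟩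

theorem isDescClosed_image_iff (hE : E.IsAsymmetric) (hi : E.IsDescClosed (range i))
    {A : Set V} : E.IsDescClosed (i '' A) ↔ D.IsDescClosed A := by
  simp only [IsDescClosed, forall_mem_image, desc_apply i hE hi, image_subset_image_iff i.injective]

theorem isFinGen_image_iff (hE : E.IsAsymmetric) (hi : E.IsDescClosed (range i))
    {A : Set V} : E.IsFinGen (i '' A) ↔ D.IsFinGen A := by
  refine and_congr (isDescClosed_image_iff i hE hi) ⟨?_, ?_⟩
  · rintro ⟨X, hX, hXA, hXe⟩
    obtain ⟨X, hXA', rfl⟩ := subset_image_iff.1 hXA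
    refine ⟨X, hX.of_finite_image i.injective.injOn, hXA', i.injective.image_injective ?_⟩
    simp only [hXe, biUnion_image, image_iUnion₂, desc_apply i hE hi]
  · rintro ⟨X, hX, hXA, hXe⟩
    refine ⟨i '' X, hX.image i, image_mono hXA, ?_⟩
    simp only [biUnion_image, desc_apply i hE hi]
    rw [← image_iUnion₂, ← hXe]

theorem isStrong_of_image (hE : E.IsAsymmetric) (hi : E.IsDescClosed (range i)) {A : Set V}
    (h : E.IsStrong (i '' A)) : D.IsStrong A where
  closed := (isDescClosed_image_iff i hE hi).1 h.closed
  mem_of_finite_diff b hb := by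
    rw [← i.injective.mem_set_image]
    refine h.mem_of_finite_diff (i b) ?_
    rw [desc_apply i hE hi, ← image_sdiff i.injective]
    exact hb.image i
  finGen_inter b := by
    have := h.finGen_inter (i b)
    rwa [desc_apply i hE hi, ← image_inter i.injective, isFinGen_image_iff i hE hi] at this

theorem isStrong_image (hE : E.IsAsymmetric) (hi : E.IsStrong (range i)) {A : Set V}
    (h : D.IsStrong A) : E.IsStrong (i '' A) := by
  have hi' := hi.closed
  refine isStrong_of_isStrong_of_subset hi (image_subset_range _ _)
    ((isDescClosed_image_iff i hE hi').2 h.closed) ?_ ?_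
  · rintro _ ⟨b, rfl⟩ hb
    rw [desc_apply i hE hi', ← image_sdiff i.injective] at hb
    exact ⟨b, h.mem_of_finite_diff b (hb.of_finite_image i.injective.injOn), rfl⟩
  · rintro _ ⟨b, rfl⟩
    rw [desc_apply i hE hi', ← image_inter i.injective, isFinGen_image_iff i hE hi']
    exact h.finGen_inter b

end Embeddings

section RootedDigraphs

variable {V : Type u} {Γ : Digraph V} {γ : V}

theorem exists_hasWalk_root (hΓ : Γ.IsAsymmetric) (h0 : Γ.P0 γ) (v : V) :
    ∃ n, HasWalk Γ n γ v := by
  rw [exists_hasWalk_iff, ← mem_desc_iff hΓ, h0.rooted]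
  trivial

theorem hasWalk_root_unique (hΓ : Γ.IsAsymmetric) (h0 : Γ.P0 γ) {s t : ℕ} {v : V}
    (hs : HasWalk Γ s γ v) (ht : HasWalk Γ t γ v) : s = t := by
  by_contra hne
  have hv : v ∈ Γ.layer s γ ∩ Γ.layer t γ := ⟨(mem_layer_iff hΓ).2 hs, (mem_layer_iff hΓ).2 ht⟩
  rwa [h0.disjoint_layers s t hne] at hv

theorem reflTransGen_antisymm (hΓ : Γ.IsAsymmetric) (h0 : Γ.P0 γ) {x y : V}
    (hxy : ReflTransGen Γ.Adj x y) (hyx : ReflTransGen Γ.Adj y x) : x = y := by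
  obtain ⟨n, hn⟩ := exists_hasWalk_root hΓ h0 x
  obtain ⟨s, hs⟩ := exists_hasWalk_iff.2 hxy
  obtain ⟨t, ht⟩ := exists_hasWalk_iff.2 hyx
  have := hasWalk_root_unique hΓ h0 hn ((hn.trans hs).trans ht)
  obtain rfl : s = 0 := by lia
  exact hs

theorem finite_outSet (h0 : Γ.P0 γ) (v : V) : (Γ.outSet v).Finite := by
  obtain ⟨m, -, hm⟩ := h0.outValency
  exact finite_of_encard_eq_coe (hm v)

theorem exists_adj (h0 : Γ.P0 γ) (v : V) : ∃ w, Γ.Adj v w := by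
  obtain ⟨m, hm, hv⟩ := h0.outValency
  have : (Γ.outSet v).Nonempty := by
    rw [← encard_ne_zero, hv v]
    exact_mod_cast hm.ne'
  exact this

theorem exists_hasWalk (h0 : Γ.P0 γ) (n : ℕ) (u : V) : ∃ v, HasWalk Γ n u v := by
  induction n with
  | zero => exact ⟨u, rfl⟩
  | succ n ih =>
    obtain ⟨w, hw⟩ := ih
    obtain ⟨v, hv⟩ := exists_adj h0 w
    exact ⟨v, w, hw, hv⟩

theorem finite_setOf_hasWalk (h0 : Γ.P0 γ) (n : ℕ) (u : V) : {v | HasWalk Γ n u v}.Finite := by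
  induction n with
  | zero => exact (finite_singleton u).subset fun v hv => by cases hv; rfl
  | succ n ih =>
    exact (ih.biUnion fun w _ => finite_outSet h0 w).subset fun v ⟨w, hw, hwv⟩ =>
      mem_biUnion hw hwv

theorem infinite_of_p0 (hΓ : Γ.IsAsymmetric) (h0 : Γ.P0 γ) : Infinite V := by
  choose f hf using fun n => exists_hasWalk h0 n γ
  exact Infinite.of_injective f fun s t h => hasWalk_root_unique hΓ h0 (hf s) (h ▸ hf t)

theorem countable_of_p0 (hΓ : Γ.IsAsymmetric) (h0 : Γ.P0 γ) : Countable V := by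
  rw [← countable_univ_iff]
  refine (countable_iUnion fun n => (finite_setOf_hasWalk h0 n γ).countable).mono fun v _ => ?_
  exact mem_iUnion.2 (exists_hasWalk_root hΓ h0 v)

theorem embedding_apply_root {W : Type v} {D : Digraph W} (hΓ : Γ.IsAsymmetric) (h0 : Γ.P0 γ)
    (hD : D.IsAsymmetric) {θ : Γ.Adj ↪r D.Adj} {a : W} (hθ : range θ = D.desc a) : θ γ = a := by
  have hclosed : D.IsDescClosed (range θ) := hθ ▸ isDescClosed_desc hD a
  obtain ⟨x, rfl⟩ : a ∈ range θ := hθ ▸ self_mem_desc hD a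
  rw [desc_apply θ hD hclosed, ← image_univ, image_eq_image θ.injective] at hθ
  have hγx : γ ∈ Γ.desc x := hθ ▸ mem_univ _
  have hxγ : x ∈ Γ.desc γ := h0.rooted ▸ mem_univ _
  rw [mem_desc_iff hΓ] at hγx hxγ
  rw [reflTransGen_antisymm hΓ h0 hγx hxγ]

theorem aut_apply_root (hΓ : Γ.IsAsymmetric) (h0 : Γ.P0 γ) (g : Γ.Aut) : g γ = γ :=
  embedding_apply_root (θ := g.toRelEmbedding) hΓ h0 hΓ
    ((g.surjective.range_eq).trans h0.rooted.symm)

theorem hasWalk_root_apply (hΓ : Γ.IsAsymmetric) (h0 : Γ.P0 γ) (g : Γ.Aut) {n : ℕ} {v : V}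
    (h : HasWalk Γ n γ v) : HasWalk Γ n γ (g v) := by
  have hg := h.map g.toRelEmbedding.toRelHom
  rwa [show g.toRelEmbedding.toRelHom γ = γ from aut_apply_root hΓ h0 g] at hg

end RootedDigraphs

section LocalCopies

variable {V : Type u} {Γ : Digraph V} {γ : V} {W : Type v} {D : Digraph W} {a b : W}

/-- The descendant set of `a` is strong in `D` and is a copy of `Γ` with `a` in the place of the
root `γ`. -/
structure IsStrongCopyAt (Γ : Digraph V) (γ : V) (D : Digraph W) (a : W) : Prop where
  exists_embedding : ∃ θ : Γ.Adj ↪r D.Adj, θ γ = a ∧ range θ = D.desc a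
  strong : D.IsStrong (D.desc a)

/-- An asymmetric digraph all of whose descendant sets are strong copies of `Γ`. This is the class
of digraphs which the construction of the homogeneous limit stays in. -/
structure IsLocally (Γ : Digraph V) (γ : V) (D : Digraph W) : Prop where
  asymm : D.IsAsymmetric
  copyAt : ∀ a, IsStrongCopyAt Γ γ D a

theorem IsStrongCopyAt.apply {X : Type w} {E : Digraph X} (h : IsStrongCopyAt Γ γ D a)
    (i : D.Adj ↪r E.Adj) (hE : E.IsAsymmetric) (hi : E.IsStrong (range i)) :
    IsStrongCopyAt Γ γ E (i a) where
  exists_embedding := by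
    obtain ⟨θ, hroot, hrange⟩ := h.exists_embedding
    refine ⟨θ.trans i, congrArg i hroot, ?_⟩
    rw [desc_apply i hE hi.closed, ← hrange, ← range_comp]
    rfl
  strong := by
    rw [desc_apply i hE hi.closed]
    exact isStrong_image i hE hi h.strong

theorem IsStrongCopyAt.of_apply {X : Type w} {E : Digraph X} (i : D.Adj ↪r E.Adj)
    (hE : E.IsAsymmetric) (hi : E.IsDescClosed (range i)) (h : IsStrongCopyAt Γ γ E (i a)) :
    IsStrongCopyAt Γ γ D a where
  exists_embedding := by
    obtain ⟨θ, hroot, hrange⟩ := h.exists_embedding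
    rw [desc_apply i hE hi] at hrange
    obtain ⟨f, hf⟩ := exists_embedding_of_range_subset i θ (hrange ▸ image_subset_range i _)
    refine ⟨f, i.injective ((hf γ).trans hroot), i.injective.image_injective ?_⟩
    rw [← hrange, ← range_comp]
    exact congrArg range (funext hf)
  strong := isStrong_of_image i hE hi (desc_apply i hE hi a ▸ h.strong)

theorem IsLocally.of_embedding {X : Type w} {E : Digraph X} (hE : IsLocally Γ γ E)
    (i : D.Adj ↪r E.Adj) (hi : E.IsDescClosed (range i)) : IsLocally Γ γ D where
  asymm := isAsymmetric_of_embedding i hE.asymm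
  copyAt a := (hE.copyAt (i a)).of_apply i hE.asymm hi

theorem isLocally_self (hΓ : Γ.IsAsymmetric) (h0 : Γ.P0 γ) (h1 : Γ.P1) (h2 : Γ.P2) :
    IsLocally Γ γ Γ where
  asymm := hΓ
  copyAt a :=
    { exists_embedding := by
        obtain ⟨e⟩ := h1 a
        let θ : Γ.Adj ↪r Γ.Adj :=
          ⟨e.symm.toEquiv.toEmbedding.trans (Function.Embedding.subtype _), e.symm.map_rel_iff⟩
        have hθ : range θ = Γ.desc a :=
          (e.symm.surjective.range_comp Subtype.val).trans Subtype.range_coe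
        exact ⟨θ, embedding_apply_root hΓ h0 hΓ hθ, hθ⟩
      strong := h2 a }

theorem IsLocally.antisymm (hΓ : Γ.IsAsymmetric) (h0 : Γ.P0 γ) (hD : IsLocally Γ γ D)
    (hab : a ∈ D.desc b) (hba : b ∈ D.desc a) : a = b := by
  obtain ⟨θ, rfl, hθ⟩ := (hD.copyAt a).exists_embedding
  obtain ⟨y, rfl⟩ : b ∈ range θ := hθ ▸ hba
  have hclosed : D.IsDescClosed (range θ) := hθ ▸ isDescClosed_desc hD.asymm _
  rw [desc_apply θ hD.asymm hclosed, θ.injective.mem_set_image, mem_desc_iff hΓ] at hab hba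
  rw [reflTransGen_antisymm hΓ h0 hba hab]

theorem IsLocally.infinite_desc (hΓ : Γ.IsAsymmetric) (h0 : Γ.P0 γ) (hD : IsLocally Γ γ D)
    (a : W) : (D.desc a).Infinite := by
  obtain ⟨θ, -, hθ⟩ := (hD.copyAt a).exists_embedding
  have := infinite_of_p0 hΓ h0
  rw [← hθ]
  exact infinite_range_of_injective θ.injective

theorem IsLocally.countable_desc (hΓ : Γ.IsAsymmetric) (h0 : Γ.P0 γ) (hD : IsLocally Γ γ D)
    (a : W) : (D.desc a).Countable := by
  obtain ⟨θ, -, hθ⟩ := (hD.copyAt a).exists_embedding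
  have := countable_of_p0 hΓ h0
  rw [← hθ]
  exact countable_range θ

theorem IsLocally.isStrong_empty (hΓ : Γ.IsAsymmetric) (h0 : Γ.P0 γ) (hD : IsLocally Γ γ D) :
    D.IsStrong ∅ where
  closed := fun _ h => h.elim
  mem_of_finite_diff b hb := (hD.infinite_desc hΓ h0 b (by simpa using hb)).elim
  finGen_inter b := by simpa using isFinGen_empty D

theorem IsLocally.nonempty_iso (hD : IsLocally Γ γ D) (a : W) :
    Nonempty (Iso (D.induced (D.desc a)) Γ) := by
  obtain ⟨θ, -, hθ⟩ := (hD.copyAt a).exists_embedding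
  rw [← hθ]
  exact ⟨RelIso.symm ⟨Equiv.ofInjective θ θ.injective, θ.map_rel_iff⟩⟩

end LocalCopies

section Ancestors

variable {V : Type u} {Γ : Digraph V} {γ : V}

/-- The vertices of the `k`-th layer below `γ` which have `v` as a descendant. -/
def ancestors (Γ : Digraph V) (γ : V) (k : ℕ) (v : V) : Set V :=
  {u | HasWalk Γ k γ u ∧ ReflTransGen Γ.Adj u v}

theorem finite_ancestors (h0 : Γ.P0 γ) (k : ℕ) (v : V) : (ancestors Γ γ k v).Finite :=
  (finite_setOf_hasWalk h0 k γ).subset fun _ hu => hu.1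

theorem ncard_ancestors_le (h0 : Γ.P0 γ) (k : ℕ) (v : V) :
    (ancestors Γ γ k v).ncard ≤ {u | HasWalk Γ k γ u}.ncard :=
  ncard_le_ncard (fun _ hu => hu.1) (finite_setOf_hasWalk h0 k γ)

theorem ancestors_subset_of_adj {k : ℕ} {v w : V} (h : Γ.Adj w v) :
    ancestors Γ γ k w ⊆ ancestors Γ γ k v := fun _ hu => ⟨hu.1, hu.2.tail h⟩

theorem ncard_ancestors_eq (hΓ : Γ.IsAsymmetric) (h0 : Γ.P0 γ) (h3 : Γ.P3 γ) {k n : ℕ}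
    {v w : V} (hv : HasWalk Γ n γ v) (hw : HasWalk Γ n γ w) :
    (ancestors Γ γ k v).ncard = (ancestors Γ γ k w).ncard := by
  have hle : ∀ {v w}, HasWalk Γ n γ v → HasWalk Γ n γ w →
      (ancestors Γ γ k v).ncard ≤ (ancestors Γ γ k w).ncard := by
    intro v w hv hw
    obtain ⟨g, rfl⟩ := h3 n v ((mem_layer_iff hΓ).2 hv) w ((mem_layer_iff hΓ).2 hw)
    refine ncard_le_ncard_of_injOn g (fun u hu => ?_) g.injective.injOn (finite_ancestors h0 k _)
    exact ⟨hasWalk_root_apply hΓ h0 g hu.1, hu.2.lift g fun _ _ h => g.map_rel_iff.2 h⟩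
  exact (hle hv hw).antisymm (hle hw hv)

/- The number of `k`-th ancestors depends only on the layer, is nondecreasing along the layers and
bounded, hence eventually constant. -/
theorem exists_ancestors_subset (hΓ : Γ.IsAsymmetric) (h0 : Γ.P0 γ) (h3 : Γ.P3 γ) (k : ℕ) :
    ∃ N, ∀ n ≥ N, ∀ v w, HasWalk Γ n γ w → Γ.Adj w v →
      ancestors Γ γ k v ⊆ ancestors Γ γ k w := by
  choose x hx using fun n => exists_hasWalk h0 n γ
  let f : ℕ → ℕ := fun n => (ancestors Γ γ k (x n)).ncard
  have hcard : ∀ n v, HasWalk Γ n γ v → (ancestors Γ γ k v).ncard = f n := fun n v hv =>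
    ncard_ancestors_eq hΓ h0 h3 hv (hx n)
  have hmono : Monotone f := monotone_nat_of_le_succ fun n => by
    obtain ⟨w, hw, hwx⟩ := hx (n + 1)
    rw [← hcard n w hw]
    exact ncard_le_ncard (ancestors_subset_of_adj hwx) (finite_ancestors h0 k _)
  have hbdd : BddAbove (range f) := ⟨_, forall_mem_range.2 fun n => ncard_ancestors_le h0 k (x n)⟩
  obtain ⟨N, hN⟩ := Nat.sSup_mem (range_nonempty f) hbdd
  have hmax : ∀ n, f n ≤ f N := fun n => hN ▸ le_csSup hbdd (mem_range_self n)
  refine ⟨N, fun n hn v w hw hwv => (eq_of_subset_of_ncard_le (ancestors_subset_of_adj hwv) ?_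
    (finite_ancestors h0 k v)).ge⟩
  rw [hcard n w hw, hcard (n + 1) v ⟨w, hw, hwv⟩]
  exact (hmax _).trans (hmono hn)

end Ancestors

section ParentClosedSets

variable {V : Type u} {Γ : Digraph V} {γ : V} {N : ℕ}

/-- The set `Z` contains, together with a vertex in a layer below the `N`-th one, every parent of
this vertex in the preceding layer. -/
def IsParentClosedFrom (Γ : Digraph V) (γ : V) (N : ℕ) (Z : Set V) : Prop :=
  ∀ n ≥ N, ∀ v w, HasWalk Γ n γ w → Γ.Adj w v → v ∈ Z → w ∈ Z

theorem exists_isParentClosedFrom (hΓ : Γ.IsAsymmetric) (h0 : Γ.P0 γ) (h3 : Γ.P3 γ) {Z : Set V}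
    (hZ : Γ.IsFinGen Z) : ∃ N, IsParentClosedFrom Γ γ N Z := by
  obtain ⟨-, X, hX, -, rfl⟩ := hZ
  choose l hl using fun u => exists_hasWalk_root hΓ h0 u
  choose N hN using exists_ancestors_subset hΓ h0 h3
  obtain ⟨M, hM⟩ := (hX.image fun u => N (l u)).bddAbove
  refine ⟨M, fun n hn v w hw hwv hv => ?_⟩
  obtain ⟨u, hu, huv⟩ := mem_iUnion₂.1 hv
  have hle : N (l u) ≤ n := (hM ⟨u, hu, rfl⟩).trans hn
  have hanc : u ∈ ancestors Γ γ (l u) v := ⟨hl u, (mem_desc_iff hΓ).1 huv⟩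
  exact mem_iUnion₂.2 ⟨u, hu, (mem_desc_iff hΓ).2 (hN (l u) n hle v w hw hwv hanc).2⟩

theorem IsParentClosedFrom.image (hΓ : Γ.IsAsymmetric) (h0 : Γ.P0 γ) {Z : Set V}
    (hZ : IsParentClosedFrom Γ γ N Z) (g : Γ.Aut) : IsParentClosedFrom Γ γ N (g '' Z) := by
  rintro n hn _ w hw hwv ⟨v, hv, rfl⟩
  refine ⟨g.symm w, hZ n hn v _ (hasWalk_root_apply hΓ h0 g.symm hw) ?_ hv, g.apply_symm_apply w⟩
  rwa [← g.map_rel_iff, g.apply_symm_apply]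

theorem IsParentClosedFrom.iInter {ι : Sort*} {Z : ι → Set V}
    (hZ : ∀ i, IsParentClosedFrom Γ γ N (Z i)) : IsParentClosedFrom Γ γ N (⋂ i, Z i) :=
  fun n hn v w hw hwv hv =>
    mem_iInter.2 fun i => hZ i n hn v w hw hwv (mem_iInter.1 hv i)

theorem IsParentClosedFrom.eq_empty (hΓ : Γ.IsAsymmetric) (h0 : Γ.P0 γ) {Z : Set V}
    (hZ : IsParentClosedFrom Γ γ N Z) (hclosed : Γ.IsDescClosed Z)
    (hN : ∀ v, HasWalk Γ N γ v → v ∉ Z) : Z = ∅ := by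
  have hbelow : ∀ t v, HasWalk Γ (N + t) γ v → v ∉ Z := by
    intro t
    induction t with
    | zero => exact hN
    | succ t ih =>
      rintro v ⟨w, hw, hwv⟩ hv
      exact ih w hw (hZ _ (Nat.le_add_right _ _) _ _ hw hwv hv)
  refine eq_empty_of_forall_notMem fun y hy => ?_
  obtain ⟨n, hn⟩ := exists_hasWalk_root hΓ h0 y
  obtain ⟨z, hz⟩ := exists_hasWalk h0 N y
  refine hbelow n z (Nat.add_comm n N ▸ hn.trans hz) (hclosed y hy ((mem_desc_iff hΓ).2 ?_))
  exact exists_hasWalk_iff.1 ⟨N, hz⟩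

theorem exists_hasWalk_notMem (hΓ : Γ.IsAsymmetric) (h0 : Γ.P0 γ) {Z : Set V}
    (hclosed : Γ.IsDescClosed Z) (hinf : Zᶜ.Infinite) (N : ℕ) :
    ∃ x, HasWalk Γ N γ x ∧ x ∉ Z := by
  by_contra! hN
  have hbelow : ∀ t v, HasWalk Γ (N + t) γ v → v ∈ Z := by
    intro t
    induction t with
    | zero => exact hN
    | succ t ih =>
      rintro v ⟨w, hw, hwv⟩
      exact (isDescClosed_iff hΓ).1 hclosed w (ih w hw) v hwv
  refine hinf (((finite_lt_nat N).biUnion fun n _ => finite_setOf_hasWalk h0 n γ).subset ?_)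
  intro v hv
  obtain ⟨n, hn⟩ := exists_hasWalk_root hΓ h0 v
  refine mem_biUnion (x := n) (show n < N from not_le.1 fun hle => hv ?_) hn
  obtain ⟨t, rfl⟩ := Nat.exists_eq_add_of_le hle
  exact hbelow t v hn

theorem exists_finite_iInter_image_eq_empty (hΓ : Γ.IsAsymmetric) (h0 : Γ.P0 γ) (h3 : Γ.P3 γ)
    {Z : Set V} (hZ : Γ.IsFinGen Z) (hinf : Zᶜ.Infinite) :
    ∃ F : Set Γ.Aut, F.Finite ∧ ⋂ g : F, g.1 '' Z = ∅ := by
  obtain ⟨N, hN⟩ := exists_isParentClosedFrom hΓ h0 h3 hZ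
  obtain ⟨x, hx, hxZ⟩ := exists_hasWalk_notMem hΓ h0 hZ.1 hinf N
  have hmove : ∀ v, HasWalk Γ N γ v → ∃ g : Γ.Aut, g x = v := fun v hv =>
    h3 N x ((mem_layer_iff hΓ).2 hx) v ((mem_layer_iff hΓ).2 hv)
  choose! g hg using hmove
  refine ⟨g '' {v | HasWalk Γ N γ v}, (finite_setOf_hasWalk h0 N γ).image g, ?_⟩
  have hparent (e : g '' {v | HasWalk Γ N γ v}) := hN.image hΓ h0 e.1
  refine (IsParentClosedFrom.iInter hparent).eq_empty hΓ h0
    (isDescClosed_iInter fun e => ?_) fun v hv hmem => ?_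
  · refine (isDescClosed_image_iff e.1.toRelEmbedding hΓ ?_).2 hZ.1
    exact fun _ _ _ _ => e.1.surjective _
  · obtain ⟨y, hy, hyv⟩ := mem_iInter.1 hmem ⟨g v, v, hv, rfl⟩
    obtain rfl : y = x := (g v).injective (hyv.trans (hg v hv).symm)
    exact hxZ hy

theorem empty_mem_of_aut_inter_closed (hΓ : Γ.IsAsymmetric) (h0 : Γ.P0 γ) (h3 : Γ.P3 γ)
    {𝒮 : Set (Set V)} (haut : ∀ g : Γ.Aut, ∀ Z ∈ 𝒮, g '' Z ∈ 𝒮)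
    (hinter : ∀ Y ∈ 𝒮, ∀ Z ∈ 𝒮, Y ∩ Z ∈ 𝒮) {Z : Set V} (hZ : Z ∈ 𝒮) (hfg : Γ.IsFinGen Z)
    (hinf : Zᶜ.Infinite) : ∅ ∈ 𝒮 := by
  obtain ⟨F, hF, hempty⟩ := exists_finite_iInter_image_eq_empty hΓ h0 h3 hfg hinf
  have hmem : ∀ F : Set Γ.Aut, F.Finite → Z ∩ ⋂ g ∈ F, g '' Z ∈ 𝒮 := by
    intro F hF
    induction F, hF using Set.Finite.induction_on with
    | empty => simpa using hZ
    | @insert g F _ _ ih =>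
      rw [biInter_insert, inter_left_comm]
      exact hinter _ (haut g Z hZ) _ ih
  have := hmem F hF
  rwa [biInter_eq_iInter, hempty, inter_empty] at this

end ParentClosedSets

section FreeAmalgam

variable {V : Type u} {W : Type v} {X : Type w} {Γ : Digraph V} {γ : V} {D : Digraph W}
  {E : Digraph X}

/-- An isomorphism between strong sets of vertices of `D`, encoded as an embedding of the
subdigraph induced on the first one. -/
structure PartialIso (D : Digraph W) where
  dom : Set W
  toEmb : (D.induced dom).Adj ↪r D.Adj
  strong_dom : D.IsStrong dom
  strong_range : D.IsStrong (range toEmb)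

theorem exists_partialIso (i j : E.Adj ↪r D.Adj) (hi : D.IsStrong (range i))
    (hj : D.IsStrong (range j)) :
    ∃ φ : PartialIso D, φ.dom = range i ∧ range φ.toEmb = range j ∧
      ∀ x (hx : i x ∈ φ.dom), φ.toEmb ⟨i x, hx⟩ = j x := by
  let e : (D.induced (range i)).Adj ≃r E.Adj :=
    RelIso.symm ⟨Equiv.ofInjective i i.injective, i.map_rel_iff⟩
  have hrange : range (e.toRelEmbedding.trans j) = range j := e.surjective.range_comp j
  refine ⟨⟨range i, e.toRelEmbedding.trans j, hi, hrange ▸ hj⟩, rfl, hrange, fun x _ => ?_⟩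
  exact congrArg j (Equiv.ofInjective_symm_apply i.injective x)

/-- The disjoint union of `D` with one copy of `D` for each partial isomorphism `φ` of `D`, where
`φ.dom` in the copy is identified with its image under `φ` in `D`. The copies thus extend all
partial isomorphisms of `D` to embeddings. -/
def amalgam (D : Digraph W) : Digraph (W ⊕ Σ φ : PartialIso D, {x : W // x ∉ φ.dom}) where
  Adj
    | .inl x, .inl y => D.Adj x y
    | .inl _, .inr _ => False
    | .inr p, .inl z => ∃ y : p.1.dom, D.Adj p.2 y ∧ p.1.toEmb y = z
    | .inr p, .inr q => p.1 = q.1 ∧ D.Adj p.2 q.2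

theorem isAsymmetric_amalgam (hD : D.IsAsymmetric) : (amalgam D).IsAsymmetric := by
  rintro (x | p) (y | q) h h'
  · exact hD _ _ h h'
  · exact h
  · exact h'
  · exact hD _ _ h.2 h'.2

/-- The embedding of `D` as the base of its amalgam. -/
def incl (D : Digraph W) : D.Adj ↪r (amalgam D).Adj := ⟨⟨Sum.inl, Sum.inl_injective⟩, Iff.rfl⟩

open Classical in
/-- The map of `D` onto the copy of `D` in the amalgam which belongs to `φ`. -/
noncomputable def copyFun (φ : PartialIso D) (x : W) :
    W ⊕ Σ φ : PartialIso D, {x : W // x ∉ φ.dom} :=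
  if hx : x ∈ φ.dom then .inl (φ.toEmb ⟨x, hx⟩) else .inr ⟨φ, x, hx⟩

theorem copyFun_of_mem (φ : PartialIso D) {x : W} (hx : x ∈ φ.dom) :
    copyFun φ x = .inl (φ.toEmb ⟨x, hx⟩) := dif_pos hx

theorem copyFun_of_notMem (φ : PartialIso D) {x : W} (hx : x ∉ φ.dom) :
    copyFun φ x = .inr ⟨φ, x, hx⟩ := dif_neg hx

theorem copyFun_injective (φ : PartialIso D) : Function.Injective (copyFun φ) := by
  intro x y h
  by_cases hx : x ∈ φ.dom <;> by_cases hy : y ∈ φ.dom <;>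
    simp only [copyFun_of_mem, copyFun_of_notMem, hx, hy, not_false_eq_true] at h
  · exact congrArg Subtype.val (φ.toEmb.injective (Sum.inl_injective h))
  · cases h
  · cases h
  · cases h; rfl

theorem copyFun_adj_iff (hD : D.IsAsymmetric) (φ : PartialIso D) {x y : W} :
    (amalgam D).Adj (copyFun φ x) (copyFun φ y) ↔ D.Adj x y := by
  by_cases hx : x ∈ φ.dom <;> by_cases hy : y ∈ φ.dom <;>
    simp only [copyFun_of_mem, copyFun_of_notMem, hx, hy, not_false_eq_true]
  · exact φ.toEmb.map_rel_iff
  · exact ⟨False.elim, fun h => hy ((isDescClosed_iff hD).1 φ.strong_dom.closed x hx y h)⟩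
  · constructor
    · rintro ⟨z, hxz, hz⟩
      obtain rfl := φ.toEmb.injective hz
      exact hxz
    · exact fun h => ⟨⟨y, hy⟩, h, rfl⟩
  · exact and_iff_right rfl

/-- The embedding of `D` onto the copy of `D` in the amalgam which belongs to `φ`. -/
noncomputable def copy (hD : D.IsAsymmetric) (φ : PartialIso D) : D.Adj ↪r (amalgam D).Adj :=
  ⟨⟨copyFun φ, copyFun_injective φ⟩, copyFun_adj_iff hD φ⟩

theorem copy_of_mem (hD : D.IsAsymmetric) (φ : PartialIso D) {x : W} (hx : x ∈ φ.dom) :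
    copy hD φ x = incl D (φ.toEmb ⟨x, hx⟩) := copyFun_of_mem φ hx

theorem copy_of_notMem (hD : D.IsAsymmetric) (φ : PartialIso D) {x : W} (hx : x ∉ φ.dom) :
    copy hD φ x = Sum.inr ⟨φ, x, hx⟩ := copyFun_of_notMem φ hx

theorem copy_mem_range_incl_iff (hD : D.IsAsymmetric) (φ : PartialIso D) {x : W} :
    copy hD φ x ∈ range (incl D) ↔ x ∈ φ.dom := by
  refine ⟨fun ⟨y, hy⟩ => ?_, fun hx => ⟨_, (copy_of_mem hD φ hx).symm⟩⟩
  by_contra hx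
  rw [copy_of_notMem hD φ hx] at hy
  cases hy

theorem isDescClosed_range_incl (hD : D.IsAsymmetric) :
    (amalgam D).IsDescClosed (range (incl D)) := by
  rw [isDescClosed_iff (isAsymmetric_amalgam hD)]
  rintro _ ⟨x, rfl⟩ (y | p) h
  · exact ⟨y, rfl⟩
  · exact h.elim

theorem isDescClosed_range_copy (hD : D.IsAsymmetric) (φ : PartialIso D) :
    (amalgam D).IsDescClosed (range (copy hD φ)) := by
  rw [isDescClosed_iff (isAsymmetric_amalgam hD)]
  rintro _ ⟨x, rfl⟩ b h
  by_cases hx : x ∈ φ.dom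
  · rw [copy_of_mem hD φ hx] at h
    rcases b with y | p
    · obtain ⟨z, rfl⟩ := (isDescClosed_iff hD).1 φ.strong_range.closed _ ⟨_, rfl⟩ y h
      exact ⟨z, copy_of_mem hD φ z.2⟩
    · exact h.elim
  · rw [copy_of_notMem hD φ hx] at h
    rcases b with y | ⟨ψ, y, hy⟩
    · obtain ⟨z, -, rfl⟩ := h
      exact ⟨z, copy_of_mem hD φ z.2⟩
    · obtain rfl : φ = ψ := h.1
      exact ⟨y, copy_of_notMem hD φ hy⟩

theorem desc_copy (hD : D.IsAsymmetric) (φ : PartialIso D) (x : W) :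
    (amalgam D).desc (copy hD φ x) = copy hD φ '' D.desc x :=
  desc_apply _ (isAsymmetric_amalgam hD) (isDescClosed_range_copy hD φ) x

theorem isStrong_range_incl (hD : D.IsAsymmetric) : (amalgam D).IsStrong (range (incl D)) := by
  have hclosed := isDescClosed_range_incl hD
  have hinter : ∀ (φ : PartialIso D) (x : W),
      (amalgam D).desc (copy hD φ x) ∩ range (incl D) = copy hD φ '' (D.desc x ∩ φ.dom) := by
    intro φ x
    rw [desc_copy, ← image_inter_preimage]
    exact congrArg (fun A => copy hD φ '' (D.desc x ∩ A))
      (Set.ext fun _ => copy_mem_range_incl_iff hD φ)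
  refine ⟨hclosed, ?_, ?_⟩
  · rintro (x | ⟨φ, x, hx⟩) h
    · exact ⟨x, rfl⟩
    · rw [← copy_of_notMem hD φ hx, ← sdiff_inter_self_eq_sdiff, inter_comm, hinter, desc_copy,
        ← image_sdiff (copy hD φ).injective, sdiff_self_inter] at h
      exact (hx (φ.strong_dom.mem_of_finite_diff x
        (h.of_finite_image (copy hD φ).injective.injOn))).elim
  · rintro (x | ⟨φ, x, hx⟩)
    · rw [inter_eq_self_of_subset_left (hclosed (Sum.inl x) ⟨x, rfl⟩)]
      exact isFinGen_desc (isAsymmetric_amalgam hD) _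
    · rw [← copy_of_notMem hD φ hx, hinter,
        isFinGen_image_iff _ (isAsymmetric_amalgam hD) (isDescClosed_range_copy hD φ)]
      exact φ.strong_dom.finGen_inter x

theorem desc_inter_range_copy_subset (hD : D.IsAsymmetric) (φ : PartialIso D)
    {b : W ⊕ Σ φ : PartialIso D, {x : W // x ∉ φ.dom}} (hb : b ∉ range (copy hD φ)) :
    (amalgam D).desc b ∩ range (copy hD φ) ⊆ range (incl D) := by
  rcases b with x | ⟨ψ, x, hx⟩
  · exact inter_subset_left.trans (isDescClosed_range_incl hD _ ⟨x, rfl⟩)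
  · rw [← copy_of_notMem hD ψ hx, desc_copy]
    rintro _ ⟨⟨y, _, rfl⟩, z, hz⟩
    by_contra hincl
    have hyψ : y ∉ ψ.dom := fun h => hincl ((copy_mem_range_incl_iff hD ψ).2 h)
    have hzφ : z ∉ φ.dom := fun h => hincl (hz ▸ (copy_mem_range_incl_iff hD φ).2 h)
    rw [copy_of_notMem hD ψ hyψ, copy_of_notMem hD φ hzφ] at hz
    obtain rfl : φ = ψ := congrArg Sigma.fst (Sum.inr_injective hz)
    exact hb ⟨x, copy_of_notMem hD φ hx⟩

theorem isStrong_range_copy (hD : D.IsAsymmetric) (φ : PartialIso D) :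
    (amalgam D).IsStrong (range (copy hD φ)) := by
  have hasymm := isAsymmetric_amalgam hD
  have hclosed := isDescClosed_range_copy hD φ
  have hstrong := isStrong_image (incl D) hasymm (isStrong_range_incl hD) φ.strong_range
  have hsub : incl D '' range φ.toEmb ⊆ range (copy hD φ) := by
    rintro _ ⟨_, ⟨x, rfl⟩, rfl⟩
    exact ⟨x, copy_of_mem hD φ x.2⟩
  have hinter : ∀ b ∉ range (copy hD φ), (amalgam D).desc b ∩ range (copy hD φ) =
      (amalgam D).desc b ∩ incl D '' range φ.toEmb := by
    intro b hb
    refine Subset.antisymm ?_ (inter_subset_inter_right _ hsub)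
    rintro _ ⟨hz, x, rfl⟩
    have hx : x ∈ φ.dom :=
      (copy_mem_range_incl_iff hD φ).1 (desc_inter_range_copy_subset hD φ hb ⟨hz, x, rfl⟩)
    exact ⟨hz, _, ⟨⟨x, hx⟩, rfl⟩, (copy_of_mem hD φ hx).symm⟩
  refine ⟨hclosed, fun b hfin => ?_, fun b => ?_⟩
  · by_contra hb
    rw [← sdiff_self_inter, hinter b hb, sdiff_self_inter] at hfin
    exact hb (hsub (hstrong.mem_of_finite_diff b hfin))
  · by_cases hb : b ∈ range (copy hD φ)
    · rw [inter_eq_self_of_subset_left (hclosed _ hb)]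
      exact isFinGen_desc hasymm _
    · rw [hinter b hb]
      exact hstrong.finGen_inter b

theorem IsLocally.amalgam (hD : IsLocally Γ γ D) : IsLocally Γ γ (amalgam D) where
  asymm := isAsymmetric_amalgam hD.asymm
  copyAt := by
    have hasymm := isAsymmetric_amalgam hD.asymm
    rintro (x | ⟨φ, x, hx⟩)
    · exact (hD.copyAt x).apply (incl D) hasymm (isStrong_range_incl hD.asymm)
    · rw [← copy_of_notMem hD.asymm φ hx]
      exact (hD.copyAt x).apply _ hasymm (isStrong_range_copy hD.asymm φ)

theorem exists_embedding_comp_eq_incl_comp (hD : D.IsAsymmetric) (h j : E.Adj ↪r D.Adj)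
    (hh : D.IsStrong (range h)) (hj : D.IsStrong (range j)) :
    ∃ k : D.Adj ↪r (amalgam D).Adj, (amalgam D).IsStrong (range k) ∧
      ∀ x, k (h x) = incl D (j x) := by
  obtain ⟨φ, hdom, -, hφ⟩ := exists_partialIso h j hh hj
  refine ⟨copy hD φ, isStrong_range_copy hD φ, fun x => ?_⟩
  have hx : h x ∈ φ.dom := hdom ▸ mem_range_self x
  rw [copy_of_mem hD φ hx, hφ]

end FreeAmalgam

section DirectLimits

variable {X : ℕ → Type v} {D : ∀ n, Digraph (X n)} (up : ∀ n, (D n).Adj ↪r (D (n + 1)).Adj)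

/-- The composite of the embeddings `up m, …, up (n - 1)` of a chain of digraphs. -/
def transition (m n : ℕ) (h : m ≤ n) : (D m).Adj ↪r (D n).Adj :=
  Nat.leRecOn (C := fun n => (D m).Adj ↪r (D n).Adj) h (fun e => e.trans (up _))
    (RelEmbedding.refl _)

theorem transition_self (n : ℕ) : transition up n n le_rfl = RelEmbedding.refl _ :=
  Nat.leRecOn_self _

theorem transition_succ {m n : ℕ} (h : m ≤ n) (x : X m) :
    transition up m (n + 1) (h.trans n.le_succ) x = up n (transition up m n h x) :=
  congrArg (fun e : (D m).Adj ↪r (D (n + 1)).Adj => e x)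
    (Nat.leRecOn_succ (C := fun n => (D m).Adj ↪r (D n).Adj) h _)

instance directedSystem_transition : DirectedSystem X (transition up · · ·) where
  map_self n x := congrArg (fun e => e x) (transition_self up n)
  map_map k m n hnm hmk x := by
    induction k, hmk using Nat.le_induction with
    | base => rw [transition_self]; rfl
    | succ k hmk ih => rw [transition_succ up hmk, transition_succ up (hnm.trans hmk), ih]

variable {Y : Type w} {L : Digraph Y} {ι : ∀ n, (D n).Adj ↪r L.Adj}

/-- The embeddings `ι n` exhibit `L` as the union of the chain of the digraphs `D n`. -/
structure IsDirectLimit (up : ∀ n, (D n).Adj ↪r (D (n + 1)).Adj) (ι : ∀ n, (D n).Adj ↪r L.Adj) :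
    Prop where
  apply_up : ∀ n x, ι (n + 1) (up n x) = ι n x
  exists_apply_eq : ∀ a, ∃ n x, ι n x = a

theorem exists_isDirectLimit :
    ∃ (Y : Type v) (L : Digraph Y) (ι : ∀ n, (D n).Adj ↪r L.Adj), IsDirectLimit up ι := by
  let mk (n : ℕ) (x : X n) : DirectLimit X (transition up) := ⟦⟨n, x⟩⟧
  have hinj : ∀ n, Function.Injective (mk n) :=
    DirectLimit.mk_injective _ fun m n h => (transition up m n h).injective
  have hmk : ∀ {m n} (h : m ≤ n) x, mk n (transition up m n h x) = mk m x := fun h x =>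
    DirectLimit.mk_apply _ _ x h
  let L : Digraph (DirectLimit X (transition up)) :=
    ⟨fun a b => ∃ (n : ℕ) (x y : X n), mk n x = a ∧ mk n y = b ∧ (D n).Adj x y⟩
  have hadj : ∀ n (x y : X n), L.Adj (mk n x) (mk n y) ↔ (D n).Adj x y := by
    refine fun n x y => ⟨?_, fun h => ⟨n, x, y, rfl, rfl, h⟩⟩
    rintro ⟨m, x', y', hx, hy, h⟩
    rw [← (transition up n _ (le_max_left n m)).map_rel_iff]
    rw [← (transition up m _ (le_max_right n m)).map_rel_iff] at h
    rw [← hmk (le_max_left n m), ← hmk (le_max_right n m)] at hx hy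
    rwa [hinj _ hx, hinj _ hy] at h
  refine ⟨_, L, fun n => ⟨⟨mk n, hinj n⟩, hadj n _ _⟩, fun n x => ?_, fun a => ?_⟩
  · have := hmk n.le_succ x
    rwa [transition_succ up le_rfl, transition_self] at this
  · obtain ⟨n, x, hx⟩ := DirectLimit.exists_eq_mk _ a
    exact ⟨n, x, hx.symm⟩

namespace IsDirectLimit

variable {up}

theorem apply_transition (hL : IsDirectLimit up ι) {m n : ℕ} (h : m ≤ n) (x : X m) :
    ι n (transition up m n h x) = ι m x := by
  induction n, h using Nat.le_induction with
  | base => rw [transition_self]; rfl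
  | succ n h ih => rw [transition_succ up h, hL.apply_up, ih]

theorem exists_apply_eq_of_le (hL : IsDirectLimit up ι) {f : ℕ → ℕ} (hf : ∀ n, n ≤ f n) (a : Y) :
    ∃ n x, ι (f n) x = a := by
  obtain ⟨n, x, rfl⟩ := hL.exists_apply_eq a
  exact ⟨n, transition up n (f n) (hf n) x, hL.apply_transition _ _⟩

theorem range_subset_range_succ (hL : IsDirectLimit up ι) (n : ℕ) :
    range (ι n) ⊆ range (ι (n + 1)) := by
  rintro _ ⟨x, rfl⟩
  exact ⟨up n x, hL.apply_up n x⟩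

theorem exists_embedding {Z : Type*} {M : Digraph Z} (hL : IsDirectLimit up ι)
    (j : ∀ n, (D n).Adj ↪r M.Adj) (hj : ∀ n x, j (n + 1) (up n x) = j n x) :
    ∃ h : L.Adj ↪r M.Adj, ∀ n x, h (ι n x) = j n x := by
  have hjt : ∀ {m n} (h : m ≤ n) x, j n (transition up m n h x) = j m x := by
    intro m n h x
    induction n, h using Nat.le_induction with
    | base => rw [transition_self]; rfl
    | succ n h ih => rw [transition_succ up h, hj, ih]
  have hcommon : ∀ a b, ∃ n x y, ι n x = a ∧ ι n y = b := by
    intro a b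
    obtain ⟨m, x, rfl⟩ := hL.exists_apply_eq a
    obtain ⟨n, y, rfl⟩ := hL.exists_apply_eq b
    exact ⟨max m n, _, _, hL.apply_transition (le_max_left m n) x,
      hL.apply_transition (le_max_right m n) y⟩
  choose N x hx using hL.exists_apply_eq
  have hspec : ∀ n y, j (N (ι n y)) (x (ι n y)) = j n y := by
    intro n y
    rw [← hjt (le_max_left (N (ι n y)) n), ← hjt (le_max_right (N (ι n y)) n)]
    congr 1
    apply (ι _).injective
    rw [hL.apply_transition, hL.apply_transition, hx]
  refine ⟨⟨⟨fun a => j (N a) (x a), fun a b hab => ?_⟩, fun {a b} => ?_⟩, hspec⟩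
  · obtain ⟨n, y, z, rfl, rfl⟩ := hcommon a b
    simp only [hspec] at hab
    rw [(j n).injective hab]
  · obtain ⟨n, y, z, rfl, rfl⟩ := hcommon a b
    change M.Adj (j _ _) (j _ _) ↔ _
    rw [hspec, hspec, (j n).map_rel_iff, (ι n).map_rel_iff]

theorem comp_add (hL : IsDirectLimit up ι) (n : ℕ) :
    IsDirectLimit (fun k => up (n + k)) fun k => ι (n + k) where
  apply_up _ _ := hL.apply_up _ _
  exists_apply_eq := hL.exists_apply_eq_of_le fun k => Nat.le_add_left k n

theorem comp_two_mul (hL : IsDirectLimit up ι) :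
    IsDirectLimit (D := fun k => D (2 * k)) (fun k => (up (2 * k)).trans (up (2 * k + 1)))
      fun k => ι (2 * k) where
  apply_up k x := (hL.apply_up (2 * k + 1) _).trans (hL.apply_up (2 * k) x)
  exists_apply_eq := hL.exists_apply_eq_of_le fun k => Nat.le_mul_of_pos_left k two_pos

theorem exists_aut_of_seq (hL : IsDirectLimit up ι) (f : ∀ n, (D n).Adj ↪r (D (n + 1)).Adj)
    (hf : ∀ n x, f (n + 1) (f n x) = up (n + 1) (up n x)) :
    ∃ g : L.Aut, ∀ x, g (ι 0 x) = ι 1 (f 0 x) := by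
  have hff : ∀ n x, ι (n + 2) (f (n + 1) (f n x)) = ι n x := fun n x => by
    rw [hf, hL.apply_up, hL.apply_up]
  obtain ⟨h, hh⟩ := hL.comp_two_mul.exists_embedding (M := L)
    (fun k => (f (2 * k)).trans (ι (2 * k + 1))) fun k x => by
      change ι (2 * k + 3) (f (2 * k + 2) (up (2 * k + 1) (up (2 * k) x))) = _
      rw [← hf, hff]
      rfl
  have hsurj : Function.Surjective h := by
    intro a
    obtain ⟨k, y, rfl⟩ := hL.exists_apply_eq_of_le (f := fun k => 2 * k + 1) (by lia) a
    exact ⟨ι (2 * k + 2) (f (2 * k + 1) y), (hh (k + 1) _).trans (hff (2 * k + 1) y)⟩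
  exact ⟨RelIso.ofSurjective h hsurj, hh 0⟩

/- The extensions of `f` along the chain alternately define an endomorphism of the limit and its
inverse. -/
theorem exists_aut (hL : IsDirectLimit up ι)
    (hext : ∀ n (h : (D n).Adj ↪r (D (n + 1)).Adj), (D (n + 1)).IsStrong (range h) →
      ∃ k : (D (n + 1)).Adj ↪r (D (n + 2)).Adj, (D (n + 2)).IsStrong (range k) ∧
        ∀ x, k (h x) = up (n + 1) (up n x))
    {n : ℕ} (f : (D n).Adj ↪r (D (n + 1)).Adj) (hf : (D (n + 1)).IsStrong (range f)) :
    ∃ g : L.Aut, ∀ x, g (ι n x) = ι (n + 1) (f x) := by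
  choose next hnext hcomp using hext
  let F : ∀ k, {h : (D (n + k)).Adj ↪r (D (n + k + 1)).Adj //
      (D (n + k + 1)).IsStrong (range h)} :=
    fun k => Nat.rec ⟨f, hf⟩ (fun k h => ⟨next (n + k) h.1 h.2, hnext _ _ _⟩) k
  exact (hL.comp_add n).exists_aut_of_seq (fun k => (F k).1) fun k => hcomp (n + k) _ (F k).2

theorem exists_common_level (hL : IsDirectLimit up ι) {m : ℕ} (x : X m) (b : Y) :
    ∃ n, ∃ h : m ≤ n, ∃ y, ι n (transition up m n h x) = ι m x ∧ ι n y = b := by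
  obtain ⟨n, y, rfl⟩ := hL.exists_apply_eq b
  exact ⟨max m n, le_max_left m n, _, hL.apply_transition _ _,
    hL.apply_transition (le_max_right m n) y⟩

theorem isAsymmetric (hL : IsDirectLimit up ι) (hD : ∀ n, (D n).IsAsymmetric) :
    L.IsAsymmetric := by
  intro a b hab hba
  obtain ⟨m, x, rfl⟩ := hL.exists_apply_eq a
  obtain ⟨n, h, y, hx, rfl⟩ := hL.exists_common_level x b
  rw [← hx] at hab hba
  exact hD n _ _ ((ι n).map_rel_iff.1 hab) ((ι n).map_rel_iff.1 hba)

variable (hD : ∀ n, (D n).IsAsymmetric) (hup : ∀ n, (D (n + 1)).IsStrong (range (up n)))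
include hD hup

theorem isStrong_range_transition {m n : ℕ} (h : m ≤ n) :
    (D n).IsStrong (range (transition up m n h)) := by
  induction n, h using Nat.le_induction with
  | base =>
    rw [transition_self]
    exact (range_id (α := X m)).symm ▸ isStrong_univ (hD m)
  | succ n h ih =>
    have : range (transition up m (n + 1) (h.trans n.le_succ)) =
        up n '' range (transition up m n h) := by
      rw [← range_comp]
      exact congrArg range (funext (transition_succ up h))
    rw [this]
    exact isStrong_image (up n) (hD _) (hup n) ih

theorem isDescClosed_range (hL : IsDirectLimit up ι) (n : ℕ) : L.IsDescClosed (range (ι n)) := by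
  rw [isDescClosed_iff (hL.isAsymmetric hD)]
  rintro _ ⟨x, rfl⟩ b hb
  obtain ⟨k, h, y, hx, rfl⟩ := hL.exists_common_level x b
  rw [← hx, (ι k).map_rel_iff] at hb
  obtain ⟨z, rfl⟩ := (isDescClosed_iff (hD k)).1
    (isStrong_range_transition hD hup h).closed _ (mem_range_self x) y hb
  exact ⟨z, (hL.apply_transition h z).symm⟩

theorem isStrong_range (hL : IsDirectLimit up ι) (n : ℕ) : L.IsStrong (range (ι n)) := by
  have hasymm := hL.isAsymmetric hD
  have hclosed := hL.isDescClosed_range hD hup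
  have hlevel : ∀ b, ∃ k y, ∃ A, (D k).IsStrong A ∧ ι k y = b ∧ range (ι n) = ι k '' A := by
    intro b
    obtain ⟨m, y, rfl⟩ := hL.exists_apply_eq b
    refine ⟨max n m, _, _, isStrong_range_transition hD hup (le_max_left n m),
      hL.apply_transition (le_max_right n m) y, ?_⟩
    rw [← range_comp]
    exact congrArg range (funext fun x => (hL.apply_transition _ x).symm)
  refine ⟨hclosed n, fun b hb => ?_, fun b => ?_⟩ <;>
    obtain ⟨k, y, A, hA, rfl, hAn⟩ := hlevel b <;>
    rw [hAn, desc_apply (ι k) hasymm (hclosed k)] at *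
  · rw [← image_sdiff (ι k).injective] at hb
    exact mem_image_of_mem _ (hA.mem_of_finite_diff y (hb.of_finite_image (ι k).injective.injOn))
  · rw [← image_inter (ι k).injective, isFinGen_image_iff (ι k) hasymm (hclosed k)]
    exact hA.finGen_inter y

end IsDirectLimit

variable {up} in
theorem IsLocally.directLimit {V : Type u} {Γ : Digraph V} {γ : V} (hL : IsDirectLimit up ι)
    (hD : ∀ n, IsLocally Γ γ (D n)) (hup : ∀ n, (D (n + 1)).IsStrong (range (up n))) :
    IsLocally Γ γ L where
  asymm := hL.isAsymmetric fun n => (hD n).asymm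
  copyAt a := by
    obtain ⟨n, x, rfl⟩ := hL.exists_apply_eq a
    exact ((hD n).copyAt x).apply (ι n) (hL.isAsymmetric fun n => (hD n).asymm)
      (hL.isStrong_range (fun n => (hD n).asymm) hup n)

end DirectLimits

section FreeFiltrations

variable {V : Type u} {Γ : Digraph V} {γ : V} {W : Type v} {D : Digraph W}

/-- The translate of `S` by the automorphism `g` is in free position to `S` inside `T`: it meets
`S` at most in the image of `A`, and it is reached from the rest of `T` only through `S`. -/
structure IsFreeTranslate (D : Digraph W) (g : D.Aut) (A S T : Set W) : Prop where
  mem_of_apply_mem : ∀ x ∈ S, g x ∈ S → x ∈ A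
  image_subset : g '' S ⊆ T
  desc_inter_subset : ∀ c ∈ T, c ∉ g '' S → D.desc c ∩ g '' S ⊆ S

/-- A filtration of `D` by strong sets `S n` such that each partial isomorphism inside `S n` extends
to an automorphism moving `S n` to a free position in `S (n + 1)`. -/
structure IsFreeFiltration (D : Digraph W) (S : ℕ → Set W) : Prop where
  mono : Monotone S
  exists_mem : ∀ a, ∃ n, a ∈ S n
  strong : ∀ n, D.IsStrong (S n)
  exists_aut : ∀ n (φ : PartialIso D), φ.dom ⊆ S n → range φ.toEmb ⊆ S n →
    ∃ g : D.Aut, (∀ x : φ.dom, g x = φ.toEmb x) ∧ IsFreeTranslate D g φ.dom (S n) (S (n + 1))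

variable {Y : Type w} {L : Digraph Y} (hD : D.IsAsymmetric) (hL : L.IsAsymmetric)
  (ι : D.Adj ↪r L.Adj) (ι' : (amalgam D).Adj ↪r L.Adj) (hι : L.IsDescClosed (range ι))
  (hι' : L.IsDescClosed (range ι')) (hincl : ∀ x, ι' (incl D x) = ι x)

include hL hι in
theorem exists_partialIso_restrict (φ : PartialIso L)
    (hdom : φ.dom ⊆ range ι) (hrange : range φ.toEmb ⊆ range ι) :
    ∃ ψ : PartialIso D, ι '' ψ.dom = φ.dom ∧
      ∀ x (hx : x ∈ ψ.dom) (hx' : ι x ∈ φ.dom), ι (ψ.toEmb ⟨x, hx⟩) = φ.toEmb ⟨ι x, hx'⟩ := by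
  obtain ⟨i, hi⟩ := exists_embedding_of_range_subset ι (F := L.induced φ.dom)
    (Subtype.relEmbedding L.Adj _) (Subtype.range_coe.trans_subset hdom)
  obtain ⟨j, hj⟩ := exists_embedding_of_range_subset ι φ.toEmb hrange
  have himage : ι '' range i = φ.dom := by
    rw [← range_comp]
    exact (congrArg range (funext hi)).trans Subtype.range_coe
  have hjimage : ι '' range j = range φ.toEmb := by
    rw [← range_comp]
    exact congrArg range (funext hj)
  obtain ⟨ψ, hψ, -, hψi⟩ := exists_partialIso i j
    (isStrong_of_image ι hL hι (himage.symm ▸ φ.strong_dom))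
    (isStrong_of_image ι hL hι (hjimage.symm ▸ φ.strong_range))
  refine ⟨ψ, hψ ▸ himage, fun x hx hx' => ?_⟩
  obtain ⟨y, rfl⟩ : x ∈ range i := hψ ▸ hx
  rw [hψi, hj]
  exact congrArg φ.toEmb (Subtype.ext (hi y).symm)

include hL hι' hincl in
theorem isFreeTranslate_of_amalgam {φ : PartialIso D} {g : L.Aut}
    (hg : ∀ x, g (ι x) = ι' (copy hD φ x)) :
    IsFreeTranslate L g (ι '' φ.dom) (range ι) (range ι') := by
  have hι : range ι = ι' '' range (incl D) := by
    rw [← range_comp]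
    exact congrArg range (funext fun x => (hincl x).symm)
  have himage : g '' range ι = ι' '' range (copy hD φ) := by
    simp only [← range_comp]
    exact congrArg range (funext hg)
  refine ⟨?_, himage ▸ image_subset_range _ _, ?_⟩
  · rintro _ ⟨x, rfl⟩ hx
    rw [hg, hι, ι'.injective.mem_set_image, copy_mem_range_incl_iff] at hx
    exact mem_image_of_mem ι hx
  · rintro _ ⟨b, rfl⟩ hb
    rw [himage, ι'.injective.mem_set_image] at hb
    rw [himage, hι, desc_apply ι' hL hι', ← image_inter ι'.injective]
    exact image_mono (desc_inter_range_copy_subset hD φ hb)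

include hD hL hι hι' hincl in
theorem exists_isFreeTranslate
    (hext : ∀ f : D.Adj ↪r (amalgam D).Adj, (amalgam D).IsStrong (range f) →
      ∃ g : L.Aut, ∀ x, g (ι x) = ι' (f x))
    (φ : PartialIso L) (hdom : φ.dom ⊆ range ι) (hrange : range φ.toEmb ⊆ range ι) :
    ∃ g : L.Aut, (∀ x : φ.dom, g x = φ.toEmb x) ∧
      IsFreeTranslate L g φ.dom (range ι) (range ι') := by
  obtain ⟨ψ, hψdom, hψ⟩ := exists_partialIso_restrict hL ι hι φ hdom hrange
  obtain ⟨g, hg⟩ := hext (copy hD ψ) (isStrong_range_copy hD ψ)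
  refine ⟨g, ?_, hψdom ▸ isFreeTranslate_of_amalgam hD hL ι ι' hι' hincl hg⟩
  rintro ⟨_, ha⟩
  obtain ⟨x, hx, rfl⟩ := hψdom ▸ ha
  rw [hg, copy_of_mem _ _ hx, hincl, hψ x hx ha]

/-- The iterated amalgams of `D`. -/
def tower (D : Digraph W) : ℕ → Σ X : Type v, Digraph X
  | 0 => ⟨W, D⟩
  | n + 1 => ⟨_, amalgam (tower D n).2⟩

theorem IsLocally.tower (hD : IsLocally Γ γ D) (n : ℕ) : IsLocally Γ γ (tower D n).2 := by
  induction n with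
  | zero => exact hD
  | succ n ih => exact ih.amalgam

theorem IsLocally.exists_isFreeFiltration [Nonempty W] (hD : IsLocally Γ γ D) :
    ∃ (Y : Type v) (L : Digraph Y) (S : ℕ → Set Y), Nonempty Y ∧ IsLocally Γ γ L ∧
      IsFreeFiltration L S := by
  obtain ⟨Y, L, ι, hι⟩ := exists_isDirectLimit fun n => incl (StrongDesc.tower D n).2
  have hasymm n := (hD.tower n).asymm
  have hincl n := isStrong_range_incl (hasymm n)
  have hL : IsLocally Γ γ L := IsLocally.directLimit hι hD.tower hincl
  have hstrong := hι.isStrong_range hasymm hincl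
  refine ⟨Y, L, fun n => range (ι n), .map (ι 0) ‹Nonempty W›, hL,
    monotone_nat_of_le_succ hι.range_subset_range_succ, hι.exists_apply_eq, hstrong,
    fun n φ hdom hrange => ?_⟩
  exact exists_isFreeTranslate (hasymm n) hL.asymm (ι n) (ι (n + 1)) (hstrong n).closed
    (hstrong (n + 1)).closed (hι.apply_up n)
    (fun f hf => hι.exists_aut
      (fun n h hh => exists_embedding_comp_eq_incl_comp (hasymm (n + 1)) h _ hh (hincl n)) f hf)
    φ hdom hrange

end FreeFiltrations

section Homogeneity

variable {V : Type u} {Γ : Digraph V} {γ : V} {W : Type v} {D : Digraph W} {S : ℕ → Set W}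

theorem desc_aut (hD : D.IsAsymmetric) (g : D.Aut) (x : W) : D.desc (g x) = g '' D.desc x :=
  desc_apply g.toRelEmbedding hD (fun _ _ _ _ => g.surjective _) x

theorem isStrong_range_trans_aut {X : Type w} {E : Digraph X} (hD : D.IsAsymmetric)
    (i : E.Adj ↪r D.Adj) (hi : D.IsStrong (range i)) (g : D.Aut) :
    D.IsStrong (range (i.trans g.toRelEmbedding)) := by
  have hg : D.IsStrong (range g.toRelEmbedding) := g.surjective.range_eq ▸ isStrong_univ hD
  have := isStrong_image g.toRelEmbedding hD hg hi
  rwa [← range_comp] at this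

namespace IsFreeFiltration

theorem exists_subset (hS : IsFreeFiltration D S) {X : Set W} (hX : X.Finite) :
    ∃ n, X ⊆ S n := by
  lift X to Finset W using hX
  exact hS.mono.directed_le.exists_mem_subset_of_finset_subset_biUnion
    fun x _ => mem_iUnion.2 (hS.exists_mem x)

theorem exists_aut_comp (hS : IsFreeFiltration D S) {X : Type w} {E : Digraph X}
    (i j : E.Adj ↪r D.Adj) (hi : D.IsStrong (range i)) (hj : D.IsStrong (range j)) {n : ℕ}
    (hin : range i ⊆ S n) (hjn : range j ⊆ S n) :
    ∃ g : D.Aut, (∀ x, g (i x) = j x) ∧ IsFreeTranslate D g (range i) (S n) (S (n + 1)) := by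
  obtain ⟨φ, hdom, hrange, hφ⟩ := exists_partialIso i j hi hj
  obtain ⟨g, hg, hfree⟩ := hS.exists_aut n φ (hdom ▸ hin) (hrange ▸ hjn)
  exact ⟨g, fun x => (hg ⟨i x, hdom ▸ mem_range_self x⟩).trans (hφ x _), hdom ▸ hfree⟩

theorem exists_aut_fixing (hS : IsFreeFiltration D S) {A : Set W} (hA : D.IsStrong A) {n : ℕ}
    (hAn : A ⊆ S n) :
    ∃ g : D.Aut, (∀ x ∈ A, g x = x) ∧ IsFreeTranslate D g A (S n) (S (n + 1)) := by
  let ι : (D.induced A).Adj ↪r D.Adj := Subtype.relEmbedding D.Adj _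
  have hι : range ι = A := Subtype.range_coe
  obtain ⟨g, hg, hfree⟩ := hS.exists_aut_comp ι ι (hι.symm ▸ hA) (hι.symm ▸ hA)
    (hι.trans_subset hAn) (hι.trans_subset hAn)
  exact ⟨g, fun x hx => hg ⟨x, hx⟩, hι ▸ hfree⟩

theorem exists_aut_of_hasWalk (hS : IsFreeFiltration D S) (hΓ : Γ.IsAsymmetric) (h0 : Γ.P0 γ)
    (h3 : Γ.P3 γ) (hD : IsLocally Γ γ D) {s : ℕ} {u v u' v' : W} (h : HasWalk D s u v)
    (h' : HasWalk D s u' v') : ∃ g : D.Aut, g u = u' ∧ g v = v' := by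
  obtain ⟨θ, rfl, hθ⟩ := (hD.copyAt u).exists_embedding
  obtain ⟨κ, rfl, hκ⟩ := (hD.copyAt u').exists_embedding
  have hθstrong : D.IsStrong (range θ) := hθ ▸ (hD.copyAt _).strong
  have hκstrong : D.IsStrong (range κ) := hκ ▸ (hD.copyAt _).strong
  obtain ⟨x, rfl, hx⟩ := h.exists_of_apply θ hD.asymm hθstrong.closed
  obtain ⟨y, rfl, hy⟩ := h'.exists_of_apply κ hD.asymm hκstrong.closed
  obtain ⟨α, rfl⟩ := h3 s x ((mem_layer_iff hΓ).2 hx) y ((mem_layer_iff hΓ).2 hy)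
  obtain ⟨n, hn⟩ := hS.exists_subset (toFinite {θ γ, κ γ})
  have hclosed := (hS.strong n).closed
  have hrange : range (α.toRelEmbedding.trans κ) = range κ := α.surjective.range_comp κ
  obtain ⟨g, hg, -⟩ := hS.exists_aut_comp θ (α.toRelEmbedding.trans κ) hθstrong
    (hrange.symm ▸ hκstrong) (hθ.trans_subset (hclosed _ (hn (by simp))))
    ((hrange.trans hκ).trans_subset (hclosed _ (hn (by simp))))
  exact ⟨g, (hg γ).trans (congrArg κ (aut_apply_root hΓ h0 α)), hg x⟩

theorem infinite_inSet (hS : IsFreeFiltration D S) (hΓ : Γ.IsAsymmetric) (h0 : Γ.P0 γ)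
    (h3 : Γ.P3 γ) (hD : IsLocally Γ γ D) (a : W) : (D.inSet a).Infinite := by
  obtain ⟨e, hea⟩ : ∃ e, D.Adj e a := by
    obtain ⟨θ, -⟩ := (hD.copyAt a).exists_embedding
    obtain ⟨x, hx⟩ := exists_adj h0 γ
    obtain ⟨g, rfl, -⟩ := hS.exists_aut_of_hasWalk hΓ h0 h3 hD (u := θ x) (u' := a) (s := 0) rfl rfl
    exact ⟨g (θ γ), g.map_rel_iff.2 (θ.map_rel_iff.2 hx)⟩
  intro hfin
  obtain ⟨n, hn⟩ := hS.exists_subset (hfin.insert a)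
  have ha : a ∈ S n := hn (mem_insert _ _)
  obtain ⟨g, hfix, hfree⟩ :=
    hS.exists_aut_fixing (hD.copyAt a).strong ((hS.strong n).closed a ha)
  have hgea : D.Adj (g e) a := by
    rw [← hfix a (self_mem_desc hD.asymm a)]
    exact g.map_rel_iff.2 hea
  have hdesc : e ∈ D.desc a := hfree.mem_of_apply_mem e (hn (mem_insert_of_mem _ hea))
    (hn (mem_insert_of_mem _ hgea))
  obtain rfl := hD.antisymm hΓ h0 hdesc ((mem_desc_iff hD.asymm).2 (.single hea))
  exact hD.asymm _ _ hea hea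

end IsFreeFiltration

end Homogeneity

section FreePairs

variable {V : Type u} {Γ : Digraph V} {γ : V} {W : Type v} {D : Digraph W} {S : ℕ → Set W}

/-- The disjoint union of two copies of `Γ`. -/
def double (Γ : Digraph V) : Digraph (V ⊕ V) where
  Adj := Sum.LiftRel Γ.Adj Γ.Adj

theorem exists_double_embedding (hD : D.IsAsymmetric) (θ κ : Γ.Adj ↪r D.Adj)
    (hθ : D.IsDescClosed (range θ)) (hκ : D.IsDescClosed (range κ))
    (hdisj : Disjoint (range θ) (range κ)) :
    ∃ i : (double Γ).Adj ↪r D.Adj, ⇑i = Sum.elim θ κ := by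
  have hne : ∀ x y, θ x ≠ κ y := fun x y h =>
    disjoint_left.1 hdisj (mem_range_self x) (h ▸ mem_range_self y)
  have hθκ : ∀ x y, ¬ D.Adj (θ x) (κ y) := fun x y h =>
    disjoint_right.1 hdisj (mem_range_self y) ((isDescClosed_iff hD).1 hθ _ ⟨x, rfl⟩ _ h)
  have hκθ : ∀ x y, ¬ D.Adj (κ x) (θ y) := fun x y h =>
    disjoint_left.1 hdisj (mem_range_self y) ((isDescClosed_iff hD).1 hκ _ ⟨x, rfl⟩ _ h)
  refine ⟨⟨⟨Sum.elim θ κ, θ.injective.sumElim κ.injective hne⟩, ?_⟩, rfl⟩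
  rintro (x | x) (y | y) <;> simp [double, hθκ, hκθ, θ.map_rel_iff, κ.map_rel_iff]

/-- Two vertices whose descendant sets are disjoint and together form a strong set. -/
structure AreFree (D : Digraph W) (a b : W) : Prop where
  disjoint : Disjoint (D.desc a) (D.desc b)
  strong : D.IsStrong (D.desc a ∪ D.desc b)

theorem AreFree.exists_embedding {a b : W} (h : AreFree D a b) (hD : IsLocally Γ γ D) :
    ∃ i : (double Γ).Adj ↪r D.Adj, i (.inl γ) = a ∧ i (.inr γ) = b ∧
      range i = D.desc a ∪ D.desc b := by
  obtain ⟨θ, hθγ, hθ⟩ := (hD.copyAt a).exists_embedding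
  obtain ⟨κ, hκγ, hκ⟩ := (hD.copyAt b).exists_embedding
  obtain ⟨i, hi⟩ := exists_double_embedding hD.asymm θ κ (hθ ▸ isDescClosed_desc hD.asymm a)
    (hκ ▸ isDescClosed_desc hD.asymm b) (hθ ▸ hκ ▸ h.disjoint)
  exact ⟨i, by simpa [hi] using hθγ, by simpa [hi] using hκγ, by rw [hi, Sum.elim_range, hθ, hκ]⟩

theorem IsFreeFiltration.exists_aut_of_areFree (hS : IsFreeFiltration D S) (hD : IsLocally Γ γ D)
    {a b a' b' : W} (h : AreFree D a b) (h' : AreFree D a' b') :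
    ∃ g : D.Aut, g a = a' ∧ g b = b' := by
  obtain ⟨i, rfl, rfl, hi⟩ := h.exists_embedding hD
  obtain ⟨j, rfl, rfl, hj⟩ := h'.exists_embedding hD
  obtain ⟨n, hn⟩ :=
    hS.exists_subset (toFinite {i (.inl γ), i (.inr γ), j (.inl γ), j (.inr γ)})
  have hclosed := (hS.strong n).closed
  obtain ⟨g, hg, -⟩ := hS.exists_aut_comp i j (hi.symm ▸ h.strong) (hj.symm ▸ h'.strong) (n := n)
    (hi.trans_subset (union_subset (hclosed _ (hn (by simp))) (hclosed _ (hn (by simp)))))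
    (hj.trans_subset (union_subset (hclosed _ (hn (by simp))) (hclosed _ (hn (by simp)))))
  exact ⟨g, hg _, hg _⟩

theorem isStrong_union_of_inter_eq_empty {T A B : Set W} (hT : D.IsStrong T) (hA : D.IsStrong A)
    (hB : D.IsStrong B) (hAT : A ⊆ T) (hBT : B ⊆ T)
    (h : ∀ c ∈ T, D.desc c ∩ A = ∅ ∨ D.desc c ∩ B = ∅) : D.IsStrong (A ∪ B) := by
  refine isStrong_of_isStrong_of_subset hT (union_subset hAT hBT)
    (isDescClosed_union hA.closed hB.closed) (fun c hc hfin => ?_) fun c _ => ?_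
  · rw [← sdiff_self_inter, inter_union_distrib_left] at hfin
    rcases h c hc with h | h
    · exact .inr (hB.mem_of_finite_diff c (by rwa [h, empty_union, sdiff_self_inter] at hfin))
    · exact .inl (hA.mem_of_finite_diff c (by rwa [h, union_empty, sdiff_self_inter] at hfin))
  · rw [inter_union_distrib_left]
    exact isFinGen_union (hA.finGen_inter c) (hB.finGen_inter c)

theorem IsFreeTranslate.areFree {g : D.Aut} {A S T : Set W} (h : IsFreeTranslate D g A S T)
    (hD : IsLocally Γ γ D) (hS : D.IsDescClosed S) (hT : D.IsStrong T) (hST : S ⊆ T) {p q : W}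
    (hp : p ∈ S) (hq : q ∈ S) (hqA : Disjoint (D.desc q) A)
    (hpA : Disjoint (D.desc p) (g '' A)) : AreFree D p (g q) := by
  have hgq : D.desc (g q) ⊆ g '' S := desc_aut hD.asymm g q ▸ image_mono (hS q hq)
  have hdisj : Disjoint S (D.desc (g q)) := by
    rw [disjoint_right, desc_aut hD.asymm]
    rintro _ ⟨c, hc, rfl⟩ hgc
    exact disjoint_left.1 hqA hc (h.mem_of_apply_mem c (hS q hq hc) hgc)
  refine ⟨hdisj.mono_left (hS p hp), isStrong_union_of_inter_eq_empty hT (hD.copyAt p).strong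
    (hD.copyAt _).strong ((hS p hp).trans hST) (hgq.trans h.image_subset) fun c hc => ?_⟩
  simp only [← disjoint_iff_inter_eq_empty]
  by_cases hcg : c ∈ g '' S
  · obtain ⟨c, hcS, rfl⟩ := hcg
    left
    rw [disjoint_left, desc_aut hD.asymm]
    rintro _ ⟨y, hy, rfl⟩ hyp
    have hyA : y ∈ A := h.mem_of_apply_mem y (hS c hcS hy) (hS p hp hyp)
    exact disjoint_left.1 hpA hyp (mem_image_of_mem g hyA)
  · right
    rw [disjoint_left]
    exact fun y hy hyq => disjoint_right.1 hdisj hyq (h.desc_inter_subset c hc hcg ⟨hy, hgq hyq⟩)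

end FreePairs

section InvariantRelations

variable {V : Type u} {Γ : Digraph V} {γ : V} {W : Type v} {D : Digraph W} {S : ℕ → Set W}

/-- `θ` and `κ` are strongly embedded copies of `Γ` which agree on `Z` and meet in its image
only. -/
structure IsOverlap (θ κ : Γ.Adj ↪r D.Adj) (Z : Set V) : Prop where
  strong_left : D.IsStrong (range θ)
  strong_right : D.IsStrong (range κ)
  eqOn : EqOn θ κ Z
  mem_of_eq : ∀ x y, θ x = κ y → x ∈ Z

theorem IsOverlap.image {θ κ : Γ.Adj ↪r D.Adj} {Z : Set V} (h : IsOverlap θ κ Z) (α : Γ.Aut) :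
    IsOverlap (α.symm.toRelEmbedding.trans θ) (α.symm.toRelEmbedding.trans κ) (α '' Z) where
  strong_left := (α.symm.surjective.range_comp θ).symm ▸ h.strong_left
  strong_right := (α.symm.surjective.range_comp κ).symm ▸ h.strong_right
  eqOn := by
    rintro _ ⟨x, hx, rfl⟩
    simpa using h.eqOn hx
  mem_of_eq x y hxy := ⟨α.symm x, h.mem_of_eq _ _ hxy, α.apply_symm_apply x⟩

theorem IsFreeTranslate.isOverlap_inter {θ θ' κ κ' : Γ.Adj ↪r D.Adj} {Y Z : Set V} {g : D.Aut}
    {S T : Set W} (h : IsFreeTranslate D g (range κ) S T) (hD : D.IsAsymmetric)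
    (hY : IsOverlap θ θ' Y) (hZ : IsOverlap κ κ' Z) (hg : ∀ x, g (κ x) = θ x)
    (hθ' : range θ' ⊆ S) (hκ' : range κ' ⊆ S) :
    IsOverlap θ' (κ'.trans g.toRelEmbedding) (Y ∩ Z) where
  strong_left := hY.strong_right
  strong_right := isStrong_range_trans_aut hD κ' hZ.strong_right g
  eqOn x hx := by
    rw [← hY.eqOn hx.1, ← hg, hZ.eqOn hx.2]
    rfl
  mem_of_eq x y hxy := by
    have hxy : g (κ' y) = θ' x := hxy.symm
    obtain ⟨z, hz⟩ := h.mem_of_apply_mem _ (hκ' ⟨y, rfl⟩) (hxy ▸ hθ' ⟨x, rfl⟩)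
    rw [← hz, hg] at hxy
    have hzY := hY.mem_of_eq _ _ hxy
    obtain rfl := θ'.injective ((hY.eqOn hzY).symm.trans hxy)
    exact ⟨hzY, hZ.mem_of_eq _ _ hz⟩

theorem IsFreeTranslate.isOverlap_preimage {θ : Γ.Adj ↪r D.Adj} {A : Set W} {g : D.Aut}
    {S T : Set W} (h : IsFreeTranslate D g A S T) (hD : D.IsAsymmetric)
    (hfix : ∀ x ∈ A, g x = x) (hθ : D.IsStrong (range θ)) (hθS : range θ ⊆ S) :
    IsOverlap θ (θ.trans g.toRelEmbedding) (θ ⁻¹' A) where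
  strong_left := hθ
  strong_right := isStrong_range_trans_aut hD θ hθ g
  eqOn x hx := (hfix _ hx).symm
  mem_of_eq x y hxy := by
    have hxy : θ x = g (θ y) := hxy
    have hy := h.mem_of_apply_mem (θ y) (hθS ⟨y, rfl⟩) (hxy ▸ hθS ⟨x, rfl⟩)
    rwa [mem_preimage, hxy, hfix _ hy]

theorem range_eq_desc_root (h0 : Γ.P0 γ) (hD : D.IsAsymmetric) (θ : Γ.Adj ↪r D.Adj)
    (hθ : D.IsDescClosed (range θ)) : range θ = D.desc (θ γ) := by
  rw [desc_apply θ hD hθ, h0.rooted, image_univ]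

namespace IsFreeFiltration

variable {r : Setoid W}

theorem exists_isOverlap (hS : IsFreeFiltration D S) (hD : IsLocally Γ γ D)
    (hr : ∀ (g : D.Aut) x y, r x y → r (g x) (g y)) {a b : W} (hab : r a b) (hb : b ∉ D.desc a) :
    ∃ (θ κ : Γ.Adj ↪r D.Adj) (Z : Set V), r (θ γ) (κ γ) ∧ IsOverlap θ κ Z ∧ Γ.IsFinGen Z ∧
      Zᶜ.Infinite := by
  obtain ⟨θ, rfl, hθ⟩ := (hD.copyAt b).exists_embedding
  obtain ⟨n, hn⟩ := hS.exists_subset (toFinite {a, θ γ})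
  have hclosed := (hS.strong n).closed
  obtain ⟨g, hfix, hfree⟩ :=
    hS.exists_aut_fixing (hD.copyAt a).strong (hclosed a (hn (by simp)))
  have hgγ : r a (g (θ γ)) := by
    simpa only [hfix a (self_mem_desc hD.asymm a)] using hr g _ _ hab
  have himage : θ '' (θ ⁻¹' D.desc a) = D.desc (θ γ) ∩ D.desc a := by
    rw [image_preimage_eq_range_inter, hθ]
  refine ⟨θ, _, _, r.trans (r.symm hab) hgγ, hfree.isOverlap_preimage hD.asymm hfix
    (hθ ▸ (hD.copyAt _).strong) (hθ.trans_subset (hclosed _ (hn (by simp)))), ?_, fun hfin => ?_⟩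
  · rw [← isFinGen_image_iff θ hD.asymm (hθ ▸ isDescClosed_desc hD.asymm _), himage]
    exact (hD.copyAt a).strong.finGen_inter _
  · refine hb ((hD.copyAt a).strong.mem_of_finite_diff _ ((hfin.image θ).subset ?_))
    rw [← hθ]
    rintro _ ⟨⟨x, rfl⟩, hx⟩
    exact mem_image_of_mem θ hx

theorem exists_disjoint_desc (hS : IsFreeFiltration D S) (hΓ : Γ.IsAsymmetric) (h0 : Γ.P0 γ)
    (h3 : Γ.P3 γ) (hD : IsLocally Γ γ D) (hr : ∀ (g : D.Aut) x y, r x y → r (g x) (g y)) {a b : W}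
    (hab : r a b) (hb : b ∉ D.desc a) : ∃ p q, r p q ∧ Disjoint (D.desc p) (D.desc q) := by
  let 𝒮 : Set (Set V) := {Z | ∃ θ κ : Γ.Adj ↪r D.Adj, r (θ γ) (κ γ) ∧ IsOverlap θ κ Z}
  have hdesc {θ : Γ.Adj ↪r D.Adj} (hθ : D.IsStrong (range θ)) : range θ = D.desc (θ γ) :=
    range_eq_desc_root h0 hD.asymm θ hθ.closed
  have haut : ∀ α : Γ.Aut, ∀ Z ∈ 𝒮, α '' Z ∈ 𝒮 := by
    rintro α Z ⟨θ, κ, hθκ, h⟩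
    refine ⟨_, _, ?_, h.image α⟩
    exact (congrArg₂ r (congrArg θ (aut_apply_root hΓ h0 α.symm))
      (congrArg κ (aut_apply_root hΓ h0 α.symm))).mpr hθκ
  have hinter : ∀ Y ∈ 𝒮, ∀ Z ∈ 𝒮, Y ∩ Z ∈ 𝒮 := by
    rintro Y ⟨θ, θ', hθ, hY⟩ Z ⟨κ, κ', hκ, hZ⟩
    obtain ⟨n, hn⟩ := hS.exists_subset (toFinite {θ γ, θ' γ, κ γ, κ' γ})
    have hsub {η : Γ.Adj ↪r D.Adj} (hη : D.IsStrong (range η)) (hηn : η γ ∈ S n) :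
        range η ⊆ S n := (hdesc hη).trans_subset ((hS.strong n).closed _ hηn)
    obtain ⟨g, hg, hfree⟩ := hS.exists_aut_comp κ θ hZ.strong_left hY.strong_left
      (hsub hZ.strong_left (hn (by simp))) (hsub hY.strong_left (hn (by simp)))
    refine ⟨θ', _, r.trans (r.symm hθ) ?_, hfree.isOverlap_inter hD.asymm hY hZ hg
      (hsub hY.strong_right (hn (by simp))) (hsub hZ.strong_right (hn (by simp)))⟩
    rw [← hg]
    exact hr g _ _ hκ
  obtain ⟨θ, κ, Z, hθκ, hZ, hfg, hinf⟩ := hS.exists_isOverlap hD hr hab hb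
  obtain ⟨θ, κ, hθκ, h⟩ :=
    empty_mem_of_aut_inter_closed hΓ h0 h3 haut hinter ⟨θ, κ, hθκ, hZ⟩ hfg hinf
  refine ⟨θ γ, κ γ, hθκ, ?_⟩
  rw [← hdesc h.strong_left, ← hdesc h.strong_right, disjoint_left]
  rintro _ ⟨x, rfl⟩ ⟨y, hxy⟩
  exact h.mem_of_eq x y hxy.symm

theorem exists_areFree (hS : IsFreeFiltration D S) (hD : IsLocally Γ γ D)
    (hr : ∀ (g : D.Aut) x y, r x y → r (g x) (g y)) {p q : W} (hpq : r p q)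
    (hdisj : Disjoint (D.desc p) (D.desc q)) : ∃ x y, r x y ∧ AreFree D x y := by
  obtain ⟨n, hn⟩ := hS.exists_subset (toFinite {p, q})
  have hclosed := (hS.strong n).closed
  obtain ⟨g, hfix, hfree⟩ :=
    hS.exists_aut_fixing (hD.copyAt p).strong (hclosed p (hn (by simp)))
  have hgq : r p (g q) := by
    simpa only [hfix p (self_mem_desc hD.asymm p)] using hr g _ _ hpq
  refine ⟨q, g q, r.trans (r.symm hpq) hgq, hfree.areFree hD hclosed (hS.strong (n + 1))
    (hS.mono n.le_succ) (hn (by simp)) (hn (by simp)) hdisj.symm ?_⟩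
  rw [image_congr hfix, image_id']
  exact hdisj.symm

theorem rel_of_areFree (hS : IsFreeFiltration D S) (hD : IsLocally Γ γ D) (hempty : D.IsStrong ∅)
    (hr : ∀ x y, AreFree D x y → r x y) (u v : W) : r u v := by
  obtain ⟨n, hn⟩ := hS.exists_subset (toFinite {u, v})
  obtain ⟨g, -, hfree⟩ := hS.exists_aut_fixing hempty (empty_subset (S n))
  have hw : ∀ x ∈ S n, r x (g u) := fun x hx =>
    hr _ _ (hfree.areFree hD (hS.strong n).closed (hS.strong (n + 1)) (hS.mono n.le_succ) hx
      (hn (by simp)) (by simp) (by simp))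
  exact r.trans (hw u (hn (by simp))) (r.symm (hw v (hn (by simp))))

theorem rel_of_ne (hS : IsFreeFiltration D S) (hΓ : Γ.IsAsymmetric) (h0 : Γ.P0 γ) (h3 : Γ.P3 γ)
    (hD : IsLocally Γ γ D) (hr : ∀ (g : D.Aut) x y, r x y → r (g x) (g y)) {a b : W}
    (hne : a ≠ b) (hab : r a b) (u v : W) : r u v := by
  obtain ⟨p, q, hpq, hdisj⟩ : ∃ p q, r p q ∧ Disjoint (D.desc p) (D.desc q) := by
    by_cases hb : b ∈ D.desc a
    · exact hS.exists_disjoint_desc hΓ h0 h3 hD hr (r.symm hab) fun ha =>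
        hne (hD.antisymm hΓ h0 ha hb)
    · exact hS.exists_disjoint_desc hΓ h0 h3 hD hr hab hb
  obtain ⟨x, y, hxy, hfree⟩ := hS.exists_areFree hD hr hpq hdisj
  refine hS.rel_of_areFree hD (hD.isStrong_empty hΓ h0) (fun x' y' hfree' => ?_) u v
  obtain ⟨g, rfl, rfl⟩ := hS.exists_aut_of_areFree hD hfree hfree'
  exact hr g _ _ hxy

end IsFreeFiltration

end InvariantRelations

section GroupActions

open MulAction
open scoped Pointwise

variable {G : Type u} {X : Type v} [Group G] [MulAction G X]

theorem isPreprimitive_iff_forall_setoid [IsPretransitive G X] :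
    IsPreprimitive G X ↔ ∀ r : Setoid X, (∀ (g : G) x y, r x y → r (g • x) (g • y)) →
      ∀ a b, a ≠ b → r a b → ∀ x y, r x y := by
  constructor
  · intro _ r hr a b hne hab x y
    have hblock : IsBlock G {w | r x w} := isBlock_iff_smul_eq_of_nonempty.2 fun g => by
      rintro ⟨_, ⟨w, hw, rfl⟩, hgw⟩
      have hgx : r (g • x) x := r.trans (hr g _ _ hw) (r.symm hgw)
      ext z
      rw [mem_smul_set_iff_inv_smul_mem]
      refine ⟨fun hz => r.trans (r.symm hgx) ?_, fun hz => ?_⟩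
      · simpa only [smul_inv_smul] using hr g _ _ hz
      · simpa only [inv_smul_smul, mem_ofPred_eq] using hr g⁻¹ _ _ (r.trans hgx hz)
    obtain ⟨g, rfl⟩ := exists_smul_eq G a x
    rcases IsPreprimitive.isTrivialBlock_of_isBlock hblock with hsub | huniv
    · exact absurd (hsub (r.refl _) (hr g _ _ hab)) fun h => hne (MulAction.injective g h)
    · exact huniv.symm.subset (mem_univ y)
  · refine fun h => ⟨fun {B} hB => or_iff_not_imp_left.2 fun hnontrivial => ?_⟩
    obtain ⟨a, ha, b, hb, hne⟩ := not_subsingleton_iff.1 hnontrivial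
    let r : Setoid X := ⟨fun x y => ∀ g : G, g • x ∈ B ↔ g • y ∈ B, fun _ _ => .rfl,
      fun h g => (h g).symm, fun h h' g => (h g).trans (h' g)⟩
    have hsmul : ∀ g : G, ∀ x ∈ B, ∀ y ∈ B, g • x ∈ B → g • y ∈ B := fun g x hx y hy hgx =>
      hB.smul_eq_of_mem hx hgx ▸ smul_mem_smul_set hy
    have hab : r a b := fun g => ⟨hsmul g a ha b hb, hsmul g b hb a ha⟩
    refine eq_univ_of_forall fun x => ?_
    have hax : r a x := h r (fun g x y hxy k => by simpa only [mul_smul] using hxy (k * g))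
      a b hne hab a x
    simpa only [one_smul, ha, true_iff] using hax 1

/-- A finitary form of primitivity, which can be inherited by a subset of `X`. -/
theorem exists_finite_mem_iff_mem [IsPreprimitive G X] {x y : X} (hne : x ≠ y) (z t : X) :
    ∃ F : Set G, F.Finite ∧
      ∀ B : Set X, (∀ g ∈ F, g • x ∈ B ↔ g • y ∈ B) → (z ∈ B ↔ t ∈ B) := by
  let r : Setoid X :=
    { r := fun z t => ∃ F : Set G, F.Finite ∧
        ∀ B : Set X, (∀ g ∈ F, g • x ∈ B ↔ g • y ∈ B) → (z ∈ B ↔ t ∈ B)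
      iseqv :=
        { refl := fun _ => ⟨∅, finite_empty, fun _ _ => .rfl⟩
          symm := fun ⟨F, hF, h⟩ => ⟨F, hF, fun B hB => (h B hB).symm⟩
          trans := fun ⟨F, hF, h⟩ ⟨F', hF', h'⟩ => ⟨F ∪ F', hF.union hF', fun B hB =>
            (h B fun g hg => hB g (.inl hg)).trans (h' B fun g hg => hB g (.inr hg))⟩ } }
  refine isPreprimitive_iff_forall_setoid.1 ‹IsPreprimitive G X› r ?_ x y hne
    ⟨{1}, finite_singleton 1, fun B hB => by simpa only [one_smul] using hB 1 rfl⟩ z t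
  rintro g z t ⟨F, hF, h⟩
  refine ⟨(g * ·) '' F, hF.image _, fun B hB => h ((g • ·) ⁻¹' B) fun k hk => ?_⟩
  simpa only [mul_smul, mem_preimage] using hB _ (mem_image_of_mem _ hk)

theorem isPreprimitive_stabilizer {A : Set X} [IsPretransitive (stabilizer G A) A]
    (h : ∀ x ∈ A, ∀ y ∈ A, x ≠ y → ∀ z ∈ A, ∀ t ∈ A, ∀ B : Set X,
      (∀ g ∈ stabilizer G A, g • x ∈ B ↔ g • y ∈ B) → (z ∈ B ↔ t ∈ B)) :
    IsPreprimitive (stabilizer G A) A := by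
  refine isPreprimitive_iff_forall_setoid.2 fun r hr a b hne hab z t => ?_
  have hmem (w : A) : (w : X) ∈ Subtype.val '' {w | r z w} ↔ r z w :=
    Subtype.val_injective.mem_set_image
  refine (hmem t).1 ((h a a.2 b b.2 (Subtype.coe_ne_coe.2 hne) z z.2 t t.2 _ fun g hg => ?_).1
    ((hmem z).2 (r.refl z)))
  have hgab := hr ⟨g, hg⟩ a b hab
  exact ((hmem _).trans ⟨fun h => r.trans h hgab, fun h => r.trans h (r.symm hgab)⟩).trans
    (hmem _).symm

end GroupActions

section CountableSubactions

open MulAction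
open scoped Pointwise

variable {X : Type v}

theorem exists_countable_closed (c : Set X → Set X) (hc : ∀ s, s.Finite → (c s).Countable)
    (x₀ : X) : ∃ A : Set X, A.Countable ∧ x₀ ∈ A ∧ ∀ s, s.Finite → s ⊆ A → c s ⊆ A := by
  let A : ℕ → Set X := Nat.rec {x₀} fun _ B => B ∪ ⋃ s ∈ {s | s.Finite ∧ s ⊆ B}, c s
  have hcount : ∀ n, (A n).Countable := fun n => by
    induction n with
    | zero => exact countable_singleton x₀
    | succ n ih =>
      exact ih.union ((countable_ofPred_finite_subset ih).biUnion fun s hs => hc s hs.1)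
  have hmono : Monotone A := monotone_nat_of_le_succ fun n => subset_union_left
  refine ⟨⋃ n, A n, countable_iUnion hcount, mem_iUnion.2 ⟨0, rfl⟩, fun s hs hsA => ?_⟩
  obtain ⟨n, hn⟩ : ∃ n, s ⊆ A n := by
    lift s to Finset X using hs
    exact hmono.directed_le.exists_mem_subset_of_finset_subset_biUnion hsA
  exact subset_iUnion_of_subset (n + 1) fun x hx => .inr (mem_biUnion ⟨hs, hn⟩ hx)

variable {G : Type u} [Group G] [MulAction G X]

theorem exists_countable_subset_stabilizer {ι : Type*} [Finite ι] (F : (ι → X) → Set G)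
    (hF : ∀ p, (F p).Countable) (c : X → Set X) (hc : ∀ x, (c x).Countable) (x₀ : X) :
    ∃ A : Set X, A.Countable ∧ x₀ ∈ A ∧ (∀ x ∈ A, c x ⊆ A) ∧
      ∀ p : ι → X, (∀ k, p k ∈ A) → F p ⊆ stabilizer G A := by
  let d : Set X → Set X := fun s => (⋃ x ∈ s, c x) ∪
    ⋃ p ∈ univ.pi fun _ : ι => s, ⋃ g ∈ F p, g • s ∪ g⁻¹ • s
  have hd : ∀ s, s.Finite → (d s).Countable := fun s hs =>
    (hs.countable.biUnion fun x _ => hc x).union <|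
      (countable_univ_pi fun _ => hs.countable).biUnion fun p _ => (hF p).biUnion fun g _ =>
        (hs.countable.image _).union (hs.countable.image _)
  obtain ⟨A, hA, hx₀, hcl⟩ := exists_countable_closed d hd x₀
  refine ⟨A, hA, hx₀, fun x hx => ?_, fun p hp g hg => ?_⟩
  · exact fun y hy => hcl {x} (finite_singleton x) (singleton_subset_iff.2 hx)
      (.inl (mem_biUnion rfl hy))
  · have hmem : ∀ x ∈ A, g • x ∈ A ∧ g⁻¹ • x ∈ A := fun x hx => by
      have hsub := hcl (insert x (range p)) ((finite_range p).insert x)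
        (insert_subset hx (range_subset_iff.2 hp))
      have hps : p ∈ univ.pi fun _ : ι => insert x (range p) :=
        fun k _ => mem_insert_of_mem _ (mem_range_self k)
      have hx' := mem_insert x (range p)
      exact ⟨hsub (.inr (mem_biUnion hps (mem_biUnion hg (.inl (smul_mem_smul_set hx'))))),
        hsub (.inr (mem_biUnion hps (mem_biUnion hg (.inr (smul_mem_smul_set hx')))))⟩
    refine mem_stabilizer_set.2 fun x => ⟨fun hx => ?_, fun hx => (hmem x hx).1⟩
    simpa only [inv_smul_smul] using (hmem _ hx).2

theorem exists_countable_isPreprimitive_stabilizer [IsPreprimitive G X] (c : X → Set X)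
    (hc : ∀ x, (c x).Countable) (x₀ : X) :
    ∃ A : Set X, A.Countable ∧ x₀ ∈ A ∧ (∀ x ∈ A, c x ⊆ A) ∧
      IsPreprimitive (stabilizer G A) A ∧
      ∀ x ∈ A, ∀ y ∈ A, ∀ g : G, g • x ∈ A → g • y ∈ A →
        ∃ h ∈ stabilizer G A, h • x = g • x ∧ h • y = g • y := by
  have hpair (x y z t : X) :
      ∃ F : Set G, F.Countable ∧ ∀ g : G, g • x = z → g • y = t →
        ∃ h ∈ F, h • x = z ∧ h • y = t := by
    by_cases hg : ∃ g : G, g • x = z ∧ g • y = t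
    · obtain ⟨g, hg⟩ := hg
      exact ⟨{g}, countable_singleton g, fun _ _ _ => ⟨g, rfl, hg⟩⟩
    · exact ⟨∅, countable_empty, fun g hx hy => (hg ⟨g, hx, hy⟩).elim⟩
  have hmem (x y z t : X) : ∃ F : Set G, F.Countable ∧ (x ≠ y →
      ∀ B : Set X, (∀ g ∈ F, g • x ∈ B ↔ g • y ∈ B) → (z ∈ B ↔ t ∈ B)) := by
    rcases eq_or_ne x y with rfl | hne
    · exact ⟨∅, countable_empty, fun h => (h rfl).elim⟩
    · obtain ⟨F, hF, h⟩ := exists_finite_mem_iff_mem (G := G) hne z t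
      exact ⟨F, hF.countable, fun _ => h⟩
  choose F hF hFpair using hpair
  choose F' hF' hFmem using hmem
  obtain ⟨A, hA, hx₀, hcA, hst⟩ := exists_countable_subset_stabilizer
    (fun p : Fin 4 → X => F (p 0) (p 1) (p 2) (p 3) ∪ F' (p 0) (p 1) (p 2) (p 3))
    (fun p => (hF _ _ _ _).union (hF' _ _ _ _)) c hc x₀
  have hsub {x y z t : X} (hx : x ∈ A) (hy : y ∈ A) (hz : z ∈ A) (ht : t ∈ A) :
      F x y z t ∪ F' x y z t ⊆ stabilizer G A :=
    hst ![x, y, z, t] (by simp [Fin.forall_fin_succ, hx, hy, hz, ht])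
  have hpairs : ∀ x ∈ A, ∀ y ∈ A, ∀ g : G, g • x ∈ A → g • y ∈ A →
      ∃ h ∈ stabilizer G A, h • x = g • x ∧ h • y = g • y := fun x hx y hy g hgx hgy => by
    obtain ⟨h, hh, hxy⟩ := hFpair x y _ _ g rfl rfl
    exact ⟨h, hsub hx hy hgx hgy (.inl hh), hxy⟩
  have : IsPretransitive (stabilizer G A) A := ⟨fun x z => by
    obtain ⟨g, hg⟩ := exists_smul_eq G (x : X) z
    obtain ⟨h, hh, hx, -⟩ := hpairs x x.2 x x.2 g (hg ▸ z.2) (hg ▸ z.2)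
    exact ⟨⟨h, hh⟩, Subtype.ext (hx.trans hg)⟩⟩
  exact ⟨A, hA, hx₀, hcA, isPreprimitive_stabilizer fun x hx y hy hne z hz t ht B hB =>
    hFmem x y z t hne B fun g hg => hB g (hsub hx hy hz ht (.inr hg)), hpairs⟩

end CountableSubactions

section Primitivity

variable {V : Type u} {Γ : Digraph V} {γ : V} {W : Type v} {D : Digraph W} {S : ℕ → Set W}

namespace IsFreeFiltration

theorem isDistanceTransitive (hS : IsFreeFiltration D S) (hΓ : Γ.IsAsymmetric) (h0 : Γ.P0 γ)
    (h3 : Γ.P3 γ) (hD : IsLocally Γ γ D) : D.IsDistanceTransitive := fun _ _ _ _ _ h h' =>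
  hS.exists_aut_of_hasWalk hΓ h0 h3 hD (hasWalk_of_hasArc h.1) (hasWalk_of_hasArc h'.1)

theorem isPrimitive (hS : IsFreeFiltration D S) (hΓ : Γ.IsAsymmetric) (h0 : Γ.P0 γ)
    (h3 : Γ.P3 γ) (hD : IsLocally Γ γ D) : D.IsPrimitive := by
  have : MulAction.IsPretransitive D.Aut W := ⟨fun u v => by
    obtain ⟨g, hg, -⟩ := hS.exists_aut_of_hasWalk hΓ h0 h3 hD (u := u) (u' := v) (s := 0) rfl rfl
    exact ⟨g, hg⟩⟩
  exact isPreprimitive_iff_forall_setoid.2 fun _ hr _ _ => hS.rel_of_ne hΓ h0 h3 hD hr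

end IsFreeFiltration

end Primitivity

section CountableSubdigraphs

open MulAction
open scoped Pointwise

variable {W : Type v} {D : Digraph W} {X : Type w} {E : Digraph X}

theorem exists_aut_apply_eq (i : E.Adj ↪r D.Adj) {g : D.Aut}
    (hg : g ∈ stabilizer D.Aut (range i)) : ∃ h : E.Aut, ∀ x, i (h x) = g (i x) := by
  choose f hf using fun x => (mem_stabilizer_set.1 hg (i x)).2 (mem_range_self x)
  choose f' hf' using fun x => (mem_stabilizer_set.1 (inv_mem hg) (i x)).2 (mem_range_self x)
  refine ⟨⟨⟨f, f', fun x => i.injective ?_, fun x => i.injective ?_⟩, fun {x y} => ?_⟩, hf⟩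
  · rw [hf', hf, inv_smul_smul]
  · rw [hf, hf', smul_inv_smul]
  · rw [← i.map_rel_iff]
    exact (iff_of_eq (congrArg₂ D.Adj (hf x) (hf y))).trans (g.map_rel_iff.trans i.map_rel_iff)

theorem isPrimitive_of_isPreprimitive_stabilizer (i : E.Adj ↪r D.Adj)
    (h : IsPreprimitive (stabilizer D.Aut (range i)) (range i)) : E.IsPrimitive := by
  choose φ hφ using fun g : stabilizer D.Aut (range i) => exists_aut_apply_eq i g.2
  let e := Equiv.ofInjective i i.injective
  have he (y : range i) : i (e.symm y) = y := Equiv.apply_ofInjective_symm i.injective y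
  let f : range i →ₑ[φ] X := ⟨e.symm, fun g y => i.injective <|
    (he _).trans ((congrArg g.1 (he y)).symm.trans (hφ g _).symm)⟩
  exact IsPreprimitive.of_surjective (f := f) e.symm.surjective

theorem isAtDist_apply (hD : D.IsAsymmetric) (i : E.Adj ↪r D.Adj) (hi : D.IsDescClosed (range i))
    {s : ℕ} {u v : X} (h : E.IsAtDist s u v) : D.IsAtDist s (i u) (i v) := by
  refine ⟨((hasWalk_of_hasArc h.1).map i.toRelHom).hasArc hD, fun t ht harc => h.2 t ht ?_⟩
  obtain ⟨w, hw, hwalk⟩ := (hasWalk_of_hasArc harc).exists_of_apply i hD hi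
  exact (i.injective hw ▸ hwalk).hasArc (isAsymmetric_of_embedding i hD)

theorem exists_embedding_of_countable {A : Set W} (hA : A.Countable) :
    ∃ (X : Type) (E : Digraph X) (i : E.Adj ↪r D.Adj), Countable X ∧ range i = A := by
  have := hA.to_subtype
  let e : Shrink.{0} A ≃ A := (equivShrink.{0} A).symm
  exact ⟨Shrink.{0} A, ⟨(fun x => (e x : W)) ⁻¹'o D.Adj⟩,
    .preimage (e.toEmbedding.trans (.subtype _)) D.Adj, e.injective.countable,
    (e.surjective.range_comp _).trans Subtype.range_coe⟩

theorem exists_countable_subdigraph [Nonempty W] (hD : D.IsAsymmetric) (hprim : D.IsPrimitive)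
    (hdist : D.IsDistanceTransitive) (hdesc : ∀ x, (D.desc x).Countable)
    (hin : ∀ x, (D.inSet x).Infinite) :
    ∃ (X : Type) (E : Digraph X) (i : E.Adj ↪r D.Adj), Nonempty X ∧ Countable X ∧
      D.IsDescClosed (range i) ∧ E.IsPrimitive ∧ E.IsDistanceTransitive ∧
      ∀ a, (E.inSet a).Infinite := by
  have hJ (x : W) : ∃ J ⊆ D.inSet x, J.Infinite ∧ J.Countable :=
    let f := (hin x).natEmbedding
    ⟨range fun n => (f n : W), range_subset_iff.2 fun n => (f n).2,
      infinite_range_of_injective (Subtype.val_injective.comp f.injective), countable_range _⟩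
  choose J hJsub hJinf hJcount using hJ
  have : IsPreprimitive D.Aut W := hprim
  obtain ⟨A, hA, hx₀, hcA, hstab, hpairs⟩ :=
    exists_countable_isPreprimitive_stabilizer (G := D.Aut) (fun x => D.desc x ∪ J x)
      (fun x => (hdesc x).union (hJcount x)) (Classical.arbitrary W)
  obtain ⟨X, E, i, hX, rfl⟩ := exists_embedding_of_countable (D := D) hA
  have hi : D.IsDescClosed (range i) := fun x hx => subset_union_left.trans (hcA x hx)
  refine ⟨X, E, i, ⟨hx₀.choose⟩, hX, hi, isPrimitive_of_isPreprimitive_stabilizer i hstab,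
    fun s u v u' v' h h' => ?_, fun a hfin => ?_⟩
  · obtain ⟨g, hgu, hgv⟩ := hdist s _ _ _ _ (isAtDist_apply hD i hi h) (isAtDist_apply hD i hi h')
    obtain ⟨k, hk, hku, hkv⟩ := hpairs _ (mem_range_self u) _ (mem_range_self v) g
      ⟨u', hgu.symm⟩ ⟨v', hgv.symm⟩
    obtain ⟨k', hk'⟩ := exists_aut_apply_eq i hk
    exact ⟨k', i.injective ((hk' u).trans (hku.trans hgu)),
      i.injective ((hk' v).trans (hkv.trans hgv))⟩
  · refine hJinf (i a) ((hfin.image i).subset fun w hw => ?_)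
    obtain ⟨b, rfl⟩ := hcA _ (mem_range_self a) (.inr hw)
    exact mem_image_of_mem i (i.map_rel_iff.1 (hJsub _ hw))

end CountableSubdigraphs

end StrongDesc

theorem mainTheorem2 {V : Type*} (Γ : Digraph V) (γ : V)
    (hasymm : Γ.IsAsymmetric)
    (h0 : Γ.P0 γ) (h1 : Γ.P1) (h2 : Γ.P2) (h3 : Γ.P3 γ) :
    ∃ (W : Type) (D : Digraph W),
      Nonempty W ∧ Countable W ∧ D.IsAsymmetric ∧
      D.IsPrimitive ∧
      (∀ a, (D.inSet a).Infinite) ∧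
      (∀ a, Nonempty (Digraph.Iso (D.induced (D.desc a)) Γ)) ∧
      D.IsDistanceTransitive := by
  have : Nonempty V := ⟨γ⟩
  obtain ⟨W, L, S, _, hL, hS⟩ :=
    (StrongDesc.isLocally_self hasymm h0 h1 h2).exists_isFreeFiltration
  obtain ⟨X, D, i, hX, hXcount, hi, hprim, hdist, hin⟩ :=
    StrongDesc.exists_countable_subdigraph hL.asymm (hS.isPrimitive hasymm h0 h3 hL)
      (hS.isDistanceTransitive hasymm h0 h3 hL) (hL.countable_desc hasymm h0)
      (hS.infinite_inSet hasymm h0 h3 hL)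
  have hD := hL.of_embedding i hi
  exact ⟨X, D, hX, hXcount, hD.asymm, hprim, hin, hD.nonempty_iso, hdist⟩
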